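/- Let $n\ge 1$ and $i\ge 0$ be integers. The following four sets are in bijection: (1) $\operatorname{Dis}(n+2,i)$; (2) $\operatorname{Skyt}(n-i+1,i,2)$; (3) $\operatorname{Dyck}(n+i+1,i+1,0)$; (4) $\operatorname{Tri}(n+i+3,i+1,0)$. **The sets.** Polygons are convex with vertices labelled $1,\dots,N$ counter-clockwise. $\operatorname{Dis}(N,i)$ is the set of dissections of an $N$-gon with $i$ chords, i.e. sets of $i$ chords between non-adjacent vertices, no two of which intersect in the interior; a triangulation is a dissection with $N-3$ chords ($N\ge 3$). $\operatorname{Skyt}(a,i,b)$ is the set of standard fillings (entries $1,\dots,m$, each once, where $m$ is the number of boxes; rows and columns increasing) of the skew shape $[(i+1)^b,1^{a-2}]/[(i-1)^{b-2}]$ for $a,b\ge 2$; it is empty if $a<2$ (which happens here exactly when $i\ge n$). For $b=2$ the shape is $[(i+1)^2,1^{a-2}]$. $\operatorname{Dyck}(m,\ell,s)$ is the set of Dyck paths of semi-length $m$ with $\ell$ maximal ascents of length at least $2$ (long ascents) and $s$ maximal ascents of length $1$ (singletons), with no singleton after the last long ascent. The fan sequence $\mathcal F(T)$ of a triangulation $T$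 is defined recursively: it is empty if $T$ is an edge; otherwise it consists of the fan of all triangles at the vertex of $T$ with the smallest label (the origin of the fan), followed by the fan sequences of the triangulations $T_1,\dots,T_k$, in counter-clockwise order, that remain when that vertex and its incident edges are deleted. A fan is singular if it has exactly one triangle. $\operatorname{Tri}(N,t,s)$ is the set of triangulations of an $N$-gon with $s+t$ fans, exactly $s$ of them singular, whose last fan is not singular. **The bijections.** Moreover, explicit bijections are given as follows. (a) $\operatorname{Skyt}(n-i+1,i,2)\to\operatorname{Dyck}(n+i+1,i+1,0)$. Let $m=n+i+1$ be the number of entries of $\lambda$, let $x_1<\dots<x_{i+1}$ be its first row and $y_1<\dots<y_{i+1}$ its second row, put $y_{i+2}=m+1$, $X=\{x_1,\dots,x_{i+1}\}$, $A_j=\{x_j\}\cup([y_j,y_{j+1}-1]\setminus X)$ and $a_j=|A_j|$. Then $\lambda\mapsto U^{a_1}D^{x_2-x_1}U^{a_2}D^{x_3-x_2}\cdots U^{a_{i+1}}D^{m-x_{i+1}+x_1}$. (b) $\operatorname{Skyt}(n-i+1,i,2)\to\operatorname{Tri}(n+i+3,i+1,0)$: $\lambda$ is sent to a triangulation whose successive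 fans have sizes $a_1,\dots,a_{i+1}$ and whose successive origins differ by $x_2-x_1,\dots,x_{i+1}-x_i$. (c) $\operatorname{Tri}(n+i+3,i+1,0)\to\operatorname{Dyck}(n+i+1,i+1,0)$: if the fans of $T$ have sizes $u_1,\dots,u_{i+1}$ and origins $z_1,\dots,z_{i+1}$, then $T\mapsto U^{u_1}D^{d_1}\cdots U^{u_{i+1}}D^{d_{i+1}}$, where $d_j=z_{j+1}-z_j$ for $j\le i$, and $d_{i+1}$ is the number of sides from $z_{i+1}$ counter-clockwise to $1$, minus $2$. (d) Contraction, $\operatorname{Tri}(n+i+3,i+1,0)\to\operatorname{Dis}(n+2,i)$: remove the internal diagonals of every fan of $T$, contract for each fan origin $z$ the side $(z,z+1)$, and relabel the vertices counter-clockwise, starting at the vertex $1$. (e) The inverse of (d) is expansion. Given $D\in\operatorname{Dis}(n+2,i)$, call the smallest vertex of a region its root. Replace each vertex $v$ that is the root of $k$ regions by a path of $k+1$ vertices, so that every region receives exactly one new side directly after its root: the regions with root $v$, taken clockwise around $v$ beginning next to the side that precedes $v$, receive the steps of the path in counter-clockwise order, and every chord stays at the first vertex of the path of its larger end. Relabel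 counter-clockwise from $1$. So a chord $(p,q)$ with $p<q$ becomes $(p+1+\#\{(p',q')\in D: p'<p\text{ or }(p'=p,\ q'>q)\},\ q+1+\#\{(p',q')\in D: p'<q\})$. Then triangulate every region by the fan from its smallest vertex. -/

import Mathlib

namespace FanDyck

/-! ### Skew tableaux

Tableaux are functions of a row and a column, both counted from `0`, that vanish off the diagram. -/

/-- The cells of the skew diagram `lam / mu` of two partitions given by their lists of parts. -/
def skewCells (lam mu : List ℕ) : Set (ℕ × ℕ) :=
  {p | p.1 < lam.length ∧ mu.getD p.1 0 ≤ p.2 ∧ p.2 < lam.getD p.1 0}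

/-- `T` is a standard filling of the diagram `S`: the entries are `1, …, |S|`, each used once, and
they increase along rows and down columns. -/
def IsStandardFilling (S : Set (ℕ × ℕ)) (T : ℕ → ℕ → ℕ) : Prop :=
  (∀ r c, (r, c) ∉ S → T r c = 0) ∧
  Set.BijOn (fun p : ℕ × ℕ => T p.1 p.2) S (Set.Icc 1 S.ncard) ∧
  (∀ r c c', (r, c) ∈ S → (r, c') ∈ S → c < c' → T r c < T r c') ∧
  (∀ r r' c, (r, c) ∈ S → (r', c) ∈ S → r < r' → T r c < T r' c)

/-- `Skyt(a, i, b)`: the skew tableaux of shape `[(i+1)^b, 1^(a-2)] / [(i-1)^(b-2)]`. There are none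
unless `2 ≤ a` and `2 ≤ b`, since otherwise the shape makes no sense. -/
def Skyt (a i b : ℕ) : Set (ℕ → ℕ → ℕ) :=
  {T | 2 ≤ a ∧ 2 ≤ b ∧
    IsStandardFilling
      (skewCells (List.replicate b (i + 1) ++ List.replicate (a - 2) 1)
        (List.replicate (b - 2) (i - 1))) T}

/-! ### Dyck paths -/

/-- The lengths of the maximal ascents (maximal runs of up steps) of a word, from left to right. -/
def ascents (w : List DyckStep) : List ℕ :=
  ((w.splitBy (fun x y => x == y)).filter (fun run => run.head? == some DyckStep.U)).map List.length

/-- `Dyck(n, ℓ, s)`: Dyck paths of semi-length `n` with `ℓ` long ascents and `s` singletons such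
that no singleton appears after the last long ascent. -/
def Dyck (n l s : ℕ) : Set DyckWord :=
  {p | p.semilength = n ∧
    (ascents p.toList).countP (fun m => decide (2 ≤ m)) = l ∧
    (ascents p.toList).count 1 = s ∧
    ∀ (before : List ℕ) (m : ℕ) (after : List ℕ), ascents p.toList = before ++ m :: after →
      2 ≤ m → (∀ k ∈ after, ¬ 2 ≤ k) → 1 ∉ after}

/-! ### Dissections and triangulations

The vertices of an `N`-gon are labelled `1, …, N` counter-clockwise. A chord between `p < q` is the
pair `(p, q)`; a dissection is its set of chords. -/

/-- `c` joins two non-adjacent vertices of the `N`-gon. -/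
def IsChord (N : ℕ) (c : ℕ × ℕ) : Prop :=
  1 ≤ c.1 ∧ c.1 + 1 < c.2 ∧ c.2 ≤ N ∧ ¬ (c.1 = 1 ∧ c.2 = N)

/-- The end points of `c` and `d` interlace, with `c` starting first. -/
def Crosses (c d : ℕ × ℕ) : Prop := c.1 < d.1 ∧ d.1 < c.2 ∧ c.2 < d.2

/-- `Dis(N, i)`: the dissections of an `N`-gon with `i` chords. -/
def Dis (N i : ℕ) : Set (Finset (ℕ × ℕ)) :=
  {D | (∀ c ∈ D, IsChord N c) ∧ (∀ c ∈ D, ∀ d ∈ D, ¬ Crosses c d) ∧ D.card = i}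

/-- The triangulations of an `N`-gon: the dissections with `N - 3` chords. -/
def Triangulations (N : ℕ) : Set (Finset (ℕ × ℕ)) := {T | 3 ≤ N ∧ T ∈ Dis N (N - 3)}

/-- `p < q` are joined by a side of the `N`-gon or by a chord in `T`. -/
def IsEdge (N : ℕ) (T : Finset (ℕ × ℕ)) (p q : ℕ) : Prop :=
  q = p + 1 ∨ (p = 1 ∧ q = N) ∨ (p, q) ∈ T

instance (N : ℕ) (T : Finset (ℕ × ℕ)) (p q : ℕ) : Decidable (IsEdge N T p q) := by
  unfold IsEdge; infer_instance

/-- A fan: its origin and, in counter-clockwise order, the sides opposite to the origin of its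
triangles, so that `(w, w')` stands for the triangle `origin, w, w'`. -/
structure Fan where
  origin : ℕ
  opposite : List (ℕ × ℕ)

/-- The number of triangles of a fan; a fan is singular if it is `1`. -/
def Fan.size (F : Fan) : ℕ := F.opposite.length

/-- The triangles at the vertex `a` in the part of the triangulation `T` on the vertices
`a, a+1, …, b`. -/
def trianglesAt (N : ℕ) (T : Finset (ℕ × ℕ)) (a b : ℕ) : List (ℕ × ℕ) :=
  ((List.range' (a + 1) (b - a)).product (List.range' (a + 1) (b - a))).filter
    (fun p => decide (p.1 < p.2 ∧ IsEdge N T a p.1 ∧ IsEdge N T a p.2 ∧ IsEdge N T p.1 p.2))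

theorem trianglesAt_lt {N : ℕ} {T : Finset (ℕ × ℕ)} {a b : ℕ} {p : ℕ × ℕ}
    (hp : p ∈ trianglesAt N T a b) : p.2 - p.1 < b - a := by
  obtain ⟨x, y⟩ := p
  simp only [trianglesAt, List.mem_filter, List.pair_mem_product, List.mem_range'_1,
    decide_eq_true_eq] at hp
  omega

/-- The sequence of fans of the part of `T` on the vertices `a, a+1, …, b`: empty if this part is
just an edge; otherwise the fan at the smallest vertex `a`, followed by the sequences of fans of the
triangulations left when `a` is deleted, in counter-clockwise order. Those are the parts of `T` cut
off by the sides `(w, w')` opposite to `a`, on the vertices `w, w+1, …, w'`. -/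
def fansBetween (N : ℕ) (T : Finset (ℕ × ℕ)) (a b : ℕ) : List Fan :=
  if a + 1 < b then
    ⟨a, trianglesAt N T a b⟩ ::
      (trianglesAt N T a b).attach.flatMap (fun p => fansBetween N T p.1.1 p.1.2)
  else []
termination_by b - a
decreasing_by exact trianglesAt_lt p.2

/-- The sequence of fans `F(T)` of a triangulation `T` of the `N`-gon. -/
def fans (N : ℕ) (T : Finset (ℕ × ℕ)) : List Fan := fansBetween N T 1 N

/-- `Tri(N, t, s)`: the triangulations of an `N`-gon with `s + t` fans, exactly `s` of them singular,
whose last fan is not singular. -/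
def Tri (N t s : ℕ) : Set (Finset (ℕ × ℕ)) :=
  {T | T ∈ Triangulations N ∧ (fans N T).length = s + t ∧
    (fans N T).countP (fun F => decide (F.size = 1)) = s ∧
    ∀ F, (fans N T).getLast? = some F → F.size ≠ 1}

/-! ### The maps -/

/-- Successive differences of a (weakly increasing) list. -/
def diffs (l : List ℕ) : List ℕ := List.zipWith (fun x y => y - x) l l.tail

/-- The word `U^{u₁} D^{d₁} U^{u₂} D^{d₂} ⋯`. -/
def upDownWord (u d : List ℕ) : List DyckStep :=
  (List.zipWith
    (fun x y => List.replicate x DyckStep.U ++ List.replicate y DyckStep.D) u d).flatten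

/-- The sizes of the fans of `T`. -/
def fanSizes (N : ℕ) (T : Finset (ℕ × ℕ)) : List ℕ := (fans N T).map Fan.size

/-- The origins `x₁ < x₂ < ⋯` of the fans of `T`. -/
def fanOrigins (N : ℕ) (T : Finset (ℕ × ℕ)) : List ℕ := (fans N T).map Fan.origin

/-- The word of a triangulation: the `u`'s are the sizes of the fans; the `d`'s are the distances
between successive origins and, last, the number of sides from the last origin counter-clockwise to
the vertex `1`, minus `2`. -/
def triWord (N : ℕ) (T : Finset (ℕ × ℕ)) : List DyckStep :=
  upDownWord (fanSizes N T)
    (diffs (fanOrigins N T) ++ [N + 1 - (fanOrigins N T).getLastD 0 - 2])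

/-- The first row `x₁ < ⋯ < x_{i+1}` of a tableau in `Skyt(a, i, 2)`. -/
def firstRow (i : ℕ) (T : ℕ → ℕ → ℕ) : List ℕ := (List.range (i + 1)).map (T 0)

/-- The block `A_{j+1}` of the partition of `{1, …, a + 2i}` attached to `T` in `Skyt(a, i, 2)`,
for `j ≤ i`: the first-row entry of column `j`, and all entries outside the first row that are at
least the second-row entry of column `j` and less than that of column `j + 1` (if there is one). -/
def nomBlock (a i : ℕ) (T : ℕ → ℕ → ℕ) (j : ℕ) : Finset ℕ :=
  insert (T 0 j)
    (Finset.Ico (T 1 j) (if j < i then T 1 (j + 1) else a + 2 * i + 1) \ (firstRow i T).toFinset)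

/-- The sizes of the blocks. -/
def nomSizes (a i : ℕ) (T : ℕ → ℕ → ℕ) : List ℕ :=
  (List.range (i + 1)).map (fun j => (nomBlock a i T j).card)

/-- The word `U^{a₁} D^{x₂-x₁} U^{a₂} D^{x₃-x₂} ⋯ U^{a_{i+1}} D^{m-x_{i+1}+x₁}` of a tableau in
`Skyt(a, i, 2)` with `m = a + 2i` entries, where `a_j = |A_j|`. -/
def skytWord (a i : ℕ) (T : ℕ → ℕ → ℕ) : List DyckStep :=
  upDownWord (nomSizes a i T) (diffs (firstRow i T) ++ [a + 2 * i - T 0 i + T 0 0])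

/-- The internal diagonals of a fan: those that lie on two of its triangles. -/
def Fan.internalDiagonals (F : Fan) : Finset (ℕ × ℕ) :=
  ((F.opposite.map Prod.snd).toFinset ∩ (F.opposite.map Prod.fst).toFinset).image
    (fun w => (F.origin, w))

/-- The new label of the vertex `v` when the sides `(x, x + 1)`, for `x` an origin of a fan of `T`,
are contracted and the vertices are relabelled counter-clockwise starting at the vertex `1`. -/
def contractVertex (N : ℕ) (T : Finset (ℕ × ℕ)) (v : ℕ) : ℕ :=
  v - ((fanOrigins N T).toFinset.filter (fun x => x < v)).card

/-- Contraction: remove the internal diagonals of all fans of `T`, then contract the side from the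
origin of each fan to the next vertex counter-clockwise. -/
def contract (N : ℕ) (T : Finset (ℕ × ℕ)) : Finset (ℕ × ℕ) :=
  (T \ ((fans N T).map Fan.internalDiagonals).foldr (fun A B => A ∪ B) ∅).image
    (fun c => (contractVertex N T c.1, contractVertex N T c.2))

/-- The position of the chord `c` of `D` after expansion. Call the smallest vertex of a region its
root: it is `1` for the region that contains the side from the last vertex to `1`, and every other
region is cut off from that one by a chord, of which its root is the smaller end. A vertex that is
the root of `k` regions is replaced by a path of `k + 1` vertices, so that each region gets one new
side directly after its root. The regions with root `v`, taken clockwise around `v` from the side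
before `v`, take the steps of the path at `v` in order, and a chord stays at the first vertex of the
path of its larger end. Vertices are then relabelled counter-clockwise from `1`. -/
def expandChord (D : Finset (ℕ × ℕ)) (c : ℕ × ℕ) : ℕ × ℕ :=
  (c.1 + 1 + (D.filter (fun d => d.1 < c.1 ∨ (d.1 = c.1 ∧ c.2 < d.2))).card,
   c.2 + 1 + (D.filter (fun d => d.1 < c.2)).card)

/-- The fan diagonals, from its smallest vertex, of the region lying directly below `r` (a chord
in `E` or the side `(1, N)`) in the polygon dissected by `E`. -/
def regionDiagonals (E : Finset (ℕ × ℕ)) (r : ℕ × ℕ) : Finset (ℕ × ℕ) :=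
  ((Finset.Ioo (r.1 + 1) r.2).filter (fun v =>
    ∀ e ∈ E, e ≠ r → r.1 ≤ e.1 → e.2 ≤ r.2 → ¬ (e.1 < v ∧ v < e.2))).image (fun v => (r.1, v))

/-- Expansion of a dissection `D` into a triangulation of the `N`-gon: add one side to each region,
then triangulate each region by a fan with origin at its smallest vertex. -/
def expand (N : ℕ) (D : Finset (ℕ × ℕ)) : Finset (ℕ × ℕ) :=
  D.image (expandChord D) ∪
    (insert (1, N) (D.image (expandChord D))).biUnion (regionDiagonals (D.image (expandChord D)))

end FanDyck

open FanDyck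

/-! All four sets are encoded by one kind of object: Łukasiewicz sequences `o` on the positions `1,
…, N - 1`, where `N = n + i + 3`, with `i + 1` non-zero terms, none equal to `1` (`LukSeq`). The
path with steps `o v - 1` stays non-negative until it ends at `-1`.

Triangulations: `o v` counts the arcs (chords and the side `(1, N)`) whose smaller end is `v`. The
later neighbours of `v` are `v + 1` and the places where the path reaches successive new minima
after it, so they arise from `v + 1` by iterating the first-drop map `next`. Conversely, counting
apexes of triangles shows that every triangulation comes from its out-degrees. The fans sit at the
non-zero positions and have the corresponding terms as sizes (`fans_pathTri`), whence
`bijOn_pathTri`.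

Dyck paths: `o v` is the number of up steps just before the `v`-th down step. The last term is
always `0` and is dropped. Maximal ascents are the non-zero terms (`bijOn_pathWord`).

Dissections: after removal of the internal diagonals only the arcs `(v, next o v)` at non-zero
positions remain, and contraction relabels a vertex by the number of zeros before it. As no term is
`1`, the order of the non-zero positions can be read off the contracted labels (`flats_lt_or`). This
is what expansion uses, so it undoes contraction. For surjectivity, a dissection is lifted to a
non-crossing set of arcs with distinct left ends, and such a set is the set of arcs `(v, next o v)`
of a sequence (`ArcSystem`).

Tableaux: the non-zero positions are the first row `x` and the terms are the block sizes. Let `g v`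
be the number of positive integers below `v` outside the first row. With rows indexed from `0`, the
blocks before the `j`-th have total size `j + g (y j)`, while `x j = 1 + j + g (x j)`. So the path
condition at `x j` reads `g (x j) ≤ g (y j)`, which amounts to the column condition `x j < y j`
because `y j` is outside the first row (`bijOn_skytSteps`). -/

namespace FanDyck

/-! ### Łukasiewicz sequences and their triangulations -/

/-- The height, before position `v`, of the path with steps `o 1 - 1, o 2 - 1, …`. -/
def height (o : ℕ → ℕ) (v : ℕ) : ℤ := ∑ u ∈ Finset.Ico 1 v, ((o u : ℤ) - 1)

/-- `o` is the step sequence of a Łukasiewicz path on the positions `1, …, N - 1`. -/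
structure IsLukasiewicz (N : ℕ) (o : ℕ → ℕ) : Prop where
  support : ∀ u, o u ≠ 0 → 1 ≤ u ∧ u < N
  nonneg : ∀ v, 1 ≤ v → v < N → 0 ≤ height o v
  last : height o N = -1

/-- The first position after `v` at which the path is lower than at `v`. -/
noncomputable def next (o : ℕ → ℕ) (v : ℕ) : ℕ := sInf {w | v < w ∧ height o w < height o v}

/-- The edges of the triangulation with out-degrees `o v + 1`. -/
def PathEdge (o : ℕ → ℕ) (v w : ℕ) : Prop :=
  v < w ∧ (∀ u, v < u → u < w → height o w < height o u) ∧ height o v - 1 ≤ height o w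

open Classical in
/-- The triangulation of the `N`-gon with out-degrees `o v + 1`. -/
noncomputable def pathTri (N : ℕ) (o : ℕ → ℕ) : Finset (ℕ × ℕ) :=
  (Finset.Icc 1 N ×ˢ Finset.Icc 1 N).filter
    (fun c => c.1 + 1 < c.2 ∧ ¬ (c.1 = 1 ∧ c.2 = N) ∧ PathEdge o c.1 c.2)

theorem height_one (o : ℕ → ℕ) : height o 1 = 0 := by simp [height]

theorem height_succ (o : ℕ → ℕ) {v : ℕ} (hv : 1 ≤ v) :
    height o (v + 1) = height o v + o v - 1 := by
  rw [height, Finset.sum_Ico_succ_top hv, height]; ring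

theorem height_eq (o : ℕ → ℕ) {v : ℕ} (hv : 1 ≤ v) :
    height o v = ((∑ u ∈ Finset.Ico 1 v, o u : ℕ) : ℤ) - (v - 1 : ℤ) := by
  rw [height, Finset.sum_sub_distrib]; simp; omega

theorem height_sub (o : ℕ → ℕ) {v w : ℕ} (hv : 1 ≤ v) (hw : v ≤ w) :
    height o w - height o v = ((∑ u ∈ Finset.Ico v w, o u : ℕ) : ℤ) - ((w : ℤ) - v) := by
  rw [height, height, ← Finset.sum_Ico_consecutive _ hv hw, add_sub_cancel_left,
    Finset.sum_sub_distrib]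
  simp; omega

theorem PathEdge.succ (o : ℕ → ℕ) {v : ℕ} (hv : 1 ≤ v) : PathEdge o v (v + 1) :=
  ⟨by omega, fun u h1 h2 => by omega, by rw [height_succ o hv]; omega⟩

theorem mem_pathTri {N : ℕ} {o : ℕ → ℕ} {v w : ℕ} :
    (v, w) ∈ pathTri N o ↔
      1 ≤ v ∧ w ≤ N ∧ v + 1 < w ∧ ¬ (v = 1 ∧ w = N) ∧ PathEdge o v w := by
  simp only [pathTri, Finset.mem_filter, Finset.mem_product, Finset.mem_Icc]
  constructor
  · rintro ⟨h1, h2⟩; exact ⟨h1.1.1, h1.2.2, h2⟩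
  · rintro ⟨h1, h2, h3⟩; exact ⟨⟨⟨h1, by omega⟩, by omega, h2⟩, h3⟩

/-- If `c` crosses `d`, the heights at `d.1`, `c.2`, `d.2` strictly decrease, but an edge loses at
most one unit of height from end to end. -/
theorem PathEdge.not_crosses {o : ℕ → ℕ} {c d : ℕ × ℕ} (hc : PathEdge o c.1 c.2)
    (hd : PathEdge o d.1 d.2) : ¬ Crosses c d := by
  rintro ⟨h1, h2, h3⟩
  have := hc.2.1 _ h1 h2
  have := hd.2.1 _ h2 h3
  have := hd.2.2
  omega

/-! ### First drops of the path and the neighbours of a vertex -/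

namespace IsLukasiewicz

variable {N : ℕ} {o : ℕ → ℕ} (h : IsLukasiewicz N o)
include h

theorem two_le : 2 ≤ N := by
  have := h.last
  by_contra hN
  interval_cases N <;> simp [height] at this

theorem next_mem {v : ℕ} (h1 : 1 ≤ v) (h2 : v < N) :
    v < next o v ∧ height o (next o v) < height o v :=
  Nat.sInf_mem (s := {w | v < w ∧ height o w < height o v})
    ⟨N, h2, by rw [h.last]; linarith [h.nonneg v h1 h2]⟩

theorem lt_next {v : ℕ} (h1 : 1 ≤ v) (h2 : v < N) : v < next o v := (h.next_mem h1 h2).1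

theorem next_le {v : ℕ} (h1 : 1 ≤ v) (h2 : v < N) : next o v ≤ N :=
  Nat.sInf_le (show _ ∧ _ from ⟨h2, by rw [h.last]; linarith [h.nonneg v h1 h2]⟩)

omit h in
theorem _root_.FanDyck.height_le_of_lt_next {v u : ℕ} (h1 : v ≤ u) (h2 : u < next o v) :
    height o v ≤ height o u := by
  rcases h1.eq_or_lt with rfl | h1
  · exact le_rfl
  · by_contra hlt
    exact absurd (Nat.sInf_le (show _ ∧ _ from ⟨h1, not_le.mp hlt⟩)) (not_le.mpr h2)

omit h in
theorem _root_.FanDyck.next_le_of_height_lt {v w : ℕ} (h1 : v < w)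
    (h2 : height o w < height o v) : next o v ≤ w :=
  Nat.sInf_le (show _ ∧ _ from ⟨h1, h2⟩)

/-- Each step lowers the path by at most one, so the first drop below a level is a drop by exactly
one. -/
theorem height_next {v : ℕ} (h1 : 1 ≤ v) (h2 : v < N) :
    height o (next o v) = height o v - 1 := by
  obtain ⟨h3, h4⟩ := h.next_mem h1 h2
  obtain ⟨w, hw⟩ : ∃ w, next o v = w + 1 := ⟨next o v - 1, by omega⟩
  have h5 := height_le_of_lt_next (o := o) (v := v) (u := w) (by omega) (by omega)
  rw [hw, height_succ o (by omega)] at h4 ⊢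
  omega

theorem pathEdge_next {v : ℕ} (h1 : 1 ≤ v) (h2 : v < N) : PathEdge o v (next o v) := by
  have h3 := h.height_next h1 h2
  refine ⟨h.lt_next h1 h2, fun u h4 h5 => ?_, h3.ge⟩
  have := height_le_of_lt_next h4.le h5
  omega

theorem next_eq {v w : ℕ} (h1 : 1 ≤ v) (h2 : v < N) (hw : v < w)
    (hlt : height o w < height o v) (hle : ∀ u, v < u → u < w → height o v ≤ height o u) :
    next o v = w := by
  apply le_antisymm (next_le_of_height_lt hw hlt)
  by_contra hc
  have := hle _ (h.lt_next h1 h2) (not_le.mp hc)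
  have := (h.next_mem h1 h2).2
  omega

theorem next_one : next o 1 = N :=
  h.next_eq le_rfl h.two_le h.two_le (by rw [h.last, height_one]; norm_num)
    fun u h1 h2 => by rw [height_one]; exact h.nonneg u h1.le h2

theorem apply_next_sub_one {v : ℕ} (h1 : 1 ≤ v) (h2 : v < N) : o (next o v - 1) = 0 := by
  have h3 := h.lt_next h1 h2
  have h4 := height_le_of_lt_next (o := o) (v := v) (u := next o v - 1) (by omega) (by omega)
  have h5 := height_succ o (v := next o v - 1) (by omega)
  rw [Nat.sub_add_cancel (by omega), h.height_next h1 h2] at h5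
  omega

theorem next_eq_succ_iff {v : ℕ} (h1 : 1 ≤ v) (h2 : v < N) : next o v = v + 1 ↔ o v = 0 := by
  constructor
  · intro h3
    have := h.apply_next_sub_one h1 h2
    rwa [h3, Nat.add_sub_cancel] at this
  · intro h3
    exact h.next_eq h1 h2 (by omega) (by rw [height_succ o h1, h3]; simp) (fun u _ _ => by omega)

/-- The neighbours of `v` after `v` are obtained from `v + 1` by iterating `next`. -/
theorem iterate_next {v : ℕ} (h1 : 1 ≤ v) (h2 : v < N) (j : ℕ) (hj : j ≤ o v) :
    PathEdge o v ((next o)^[j] (v + 1)) ∧ (next o)^[j] (v + 1) ≤ N ∧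
      height o ((next o)^[j] (v + 1)) = height o (v + 1) - j := by
  induction j with
  | zero => exact ⟨PathEdge.succ o h1, h2, by simp⟩
  | succ j ih =>
    obtain ⟨h3, h4, h5⟩ := ih (by omega)
    rw [Function.iterate_succ_apply']
    set w := (next o)^[j] (v + 1)
    have h6 := height_succ o h1
    have h7 := h.nonneg v h1 h2
    have hw : w < N := by
      rcases h4.eq_or_lt with h8 | h8
      · rw [h8, h.last] at h5; omega
      · exact h8
    have hvw := h3.1
    have h9 := h.height_next (v := w) (by omega) hw
    have h10 := h.lt_next (v := w) (by omega) hw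
    refine ⟨⟨by omega, fun u hu1 hu2 => ?_, by omega⟩, h.next_le (by omega) hw, by
      push_cast; omega⟩
    rcases lt_or_ge u w with hu | hu
    · have := h3.2.1 u hu1 hu; omega
    · have := height_le_of_lt_next hu hu2; omega

/-- The end of an edge from `v` lies strictly below everything in between, so its height alone
determines it. -/
theorem pathEdge_iff {v w : ℕ} (h1 : 1 ≤ v) (h2 : v < N) :
    PathEdge o v w ∧ w ≤ N ↔ ∃ j ≤ o v, w = (next o)^[j] (v + 1) := by
  constructor
  · rintro ⟨h3, h4⟩
    have h6 := height_succ o h1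
    have h7 : height o w ≤ height o (v + 1) := by
      rcases eq_or_lt_of_le (show v + 1 ≤ w from h3.1) with h8 | h8
      · rw [h8]
      · exact (h3.2.1 _ (by omega) h8).le
    have h8 := h3.2.2
    refine ⟨(height o (v + 1) - height o w).toNat, by omega, ?_⟩
    set j := (height o (v + 1) - height o w).toNat with hj
    obtain ⟨h9, h10, h11⟩ := h.iterate_next h1 h2 j (by omega)
    -- Of two different neighbours of `v` the later one is strictly lower, so neighbours of equal
    -- height coincide.
    by_contra hne
    rcases lt_or_gt_of_ne hne with h12 | h12
    · have := h9.2.1 _ h3.1 h12; omega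
    · have := h3.2.1 _ h9.1 h12; omega
  · rintro ⟨j, hj, rfl⟩
    obtain ⟨h9, h10, h11⟩ := h.iterate_next h1 h2 j hj
    exact ⟨h9, h10⟩

theorem iterate_next_strictMono {v : ℕ} (h1 : 1 ≤ v) (h2 : v < N) {j k : ℕ} (hjk : j < k)
    (hk : k ≤ o v) : (next o)^[j] (v + 1) < (next o)^[k] (v + 1) := by
  obtain ⟨h9, h10, h11⟩ := h.iterate_next h1 h2 j (by omega)
  obtain ⟨g9, g10, g11⟩ := h.iterate_next h1 h2 k hk
  by_contra hlt
  rcases (not_lt.mp hlt).eq_or_lt with h12 | h12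
  · rw [h12] at g11; omega
  · have := h9.2.1 _ g9.1 h12; omega

theorem iterate_next_apply {v : ℕ} (h1 : 1 ≤ v) (h2 : v < N) :
    (next o)^[o v] (v + 1) = next o v := by
  obtain ⟨h9, h10, h11⟩ := h.iterate_next h1 h2 _ le_rfl
  have := height_succ o h1
  refine (h.next_eq h1 h2 h9.1 (by omega) fun u h3 h4 => ?_).symm
  have := h9.2.1 u h3 h4
  omega

theorem pathEdge_le_next {v w : ℕ} (h1 : 1 ≤ v) (h2 : v < N) (he : PathEdge o v w)
    (hw : w ≤ N) : w ≤ next o v := by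
  obtain ⟨j, hj, rfl⟩ := (h.pathEdge_iff h1 h2).1 ⟨he, hw⟩
  rw [← h.iterate_next_apply h1 h2]
  rcases hj.eq_or_lt with h3 | h3
  · rw [h3]
  · exact (h.iterate_next_strictMono h1 h2 h3 le_rfl).le

theorem isEdge_pathTri {v w : ℕ} (h1 : 1 ≤ v) (hvw : v < w) (hw : w ≤ N) :
    IsEdge N (pathTri N o) v w ↔ PathEdge o v w := by
  rw [IsEdge, mem_pathTri]
  constructor
  · rintro (rfl | ⟨rfl, rfl⟩ | h2)
    · exact PathEdge.succ o h1
    · have := h.pathEdge_next le_rfl hvw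
      rwa [h.next_one] at this
    · exact h2.2.2.2.2
  · intro h2
    by_cases h3 : w = v + 1
    · exact Or.inl h3
    by_cases h4 : v = 1 ∧ w = N
    · exact Or.inr (Or.inl h4)
    exact Or.inr (Or.inr ⟨h1, hw, by omega, h4, h2⟩)

/-- The arcs of the triangulation, that is, its chords and the side `(1, N)`, starting at `v`. -/
theorem card_arcs {v : ℕ} (hN : 3 ≤ N) :
    ((insert (1, N) (pathTri N o)).filter (fun e => e.1 = v)).card = o v := by
  by_cases hv : 1 ≤ v ∧ v < N
  · obtain ⟨h1, h2⟩ := hv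
    -- The index `j = 0` is left out because it gives the side `(v, v + 1)`, which is not an arc.
    have : (insert (1, N) (pathTri N o)).filter (fun e => e.1 = v) =
        (Finset.Icc 1 (o v)).image (fun j => (v, (next o)^[j] (v + 1))) := by
      ext ⟨a, b⟩
      simp only [Finset.mem_filter, Finset.mem_insert, Finset.mem_image, Finset.mem_Icc,
        Prod.mk.injEq]
      constructor
      · rintro ⟨h3, rfl⟩
        have h4 : a + 1 < b ∧ PathEdge o a b ∧ b ≤ N := by
          rcases h3 with ⟨rfl, rfl⟩ | h3
          · have := h.pathEdge_next le_rfl h2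
            rw [h.next_one] at this
            exact ⟨by omega, this, le_rfl⟩
          · rw [mem_pathTri] at h3
            exact ⟨h3.2.2.1, h3.2.2.2.2, h3.2.1⟩
        obtain ⟨j, hj, rfl⟩ := (h.pathEdge_iff h1 h2).1 h4.2
        refine ⟨j, ⟨?_, hj⟩, rfl, rfl⟩
        rcases j with _ | j
        · simp at h4
        · omega
      · rintro ⟨j, ⟨h3, h4⟩, rfl, rfl⟩
        refine ⟨?_, rfl⟩
        obtain ⟨h9, h10, h11⟩ := h.iterate_next h1 h2 j h4
        have := h.iterate_next_strictMono h1 h2 (j := 0) h3 h4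
        rw [mem_pathTri]
        by_cases h5 : v = 1 ∧ (next o)^[j] (v + 1) = N
        · exact Or.inl h5
        · exact Or.inr ⟨h1, h10, by simpa using this, h5, h9⟩
    rw [this, Finset.card_image_of_injOn, Nat.card_Icc, Nat.add_sub_cancel]
    intro j hj k hk hjk
    simp only [Finset.coe_Icc, Set.mem_Icc, Prod.mk.injEq, true_and] at hj hk hjk
    by_contra hne
    rcases lt_or_gt_of_ne hne with h3 | h3
    · exact absurd hjk (h.iterate_next_strictMono h1 h2 h3 hk.2).ne
    · exact absurd hjk (h.iterate_next_strictMono h1 h2 h3 hj.2).ne'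
  · have h0 : o v = 0 := by
      by_contra h0
      exact hv (h.support v h0)
    rw [h0, Finset.card_eq_zero, Finset.filter_eq_empty_iff]
    rintro ⟨a, b⟩ h3 rfl
    rw [Finset.mem_insert, mem_pathTri, Prod.mk.injEq] at h3
    rcases h3 with ⟨h3, -⟩ | h3
    · exact hv ⟨h3.ge, by omega⟩
    · exact hv ⟨h3.1, by omega⟩

theorem sum_eq : ∑ u ∈ Finset.Ico 1 N, o u = N - 2 := by
  have h1 := height_eq o (v := N) (by have := h.two_le; omega)
  rw [h.last] at h1
  have := h.two_le
  omega

/-- Counted by left ends, the arcs number `∑ o = N - 2`; one of them is the side `(1, N)`. -/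
theorem pathTri_mem (hN : 3 ≤ N) : pathTri N o ∈ Triangulations N := by
  refine ⟨hN, ?_, ?_, ?_⟩
  · rintro ⟨v, w⟩ h1
    rw [mem_pathTri] at h1
    exact ⟨h1.1, h1.2.2.1, h1.2.1, h1.2.2.2.1⟩
  · rintro ⟨v, w⟩ h1 ⟨v', w'⟩ h2
    rw [mem_pathTri] at h1 h2
    exact h1.2.2.2.2.not_crosses h2.2.2.2.2
  · have h1 : (insert (1, N) (pathTri N o)).card = ∑ u ∈ Finset.Ico 1 N, o u := by
      rw [Finset.card_eq_sum_card_fiberwise (f := Prod.fst) (t := Finset.Ico 1 N)]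
      · exact Finset.sum_congr rfl fun v _ => h.card_arcs hN
      · rintro ⟨a, b⟩ h3
        rw [Finset.mem_coe, Finset.mem_insert, mem_pathTri, Prod.mk.injEq] at h3
        simp only [Finset.coe_Ico, Set.mem_Ico]
        omega
    rw [h.sum_eq, Finset.card_insert_of_notMem (by simp [mem_pathTri])] at h1
    omega

end IsLukasiewicz

/-! ### Every triangulation comes from its out-degrees -/

/-- The third vertex of the triangle below the arc `e`, in a maximal non-crossing set of arcs. -/
def apex (A : Finset (ℕ × ℕ)) (e : ℕ × ℕ) : ℕ :=
  ((Finset.Ioo e.1 e.2).filter (fun m => m = e.1 + 1 ∨ (e.1, m) ∈ A)).sup id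

/-- The number of arcs (chords of `T` or the side `(1, N)`) with smaller end `v`. -/
def outDegree (N : ℕ) (T : Finset (ℕ × ℕ)) (v : ℕ) : ℕ :=
  ((insert (1, N) T).filter (fun e => e.1 = v)).card

/-! ### Counting non-crossing arcs by their apexes -/

section Apex

variable {A : Finset (ℕ × ℕ)} (hA : ∀ e ∈ A, e.1 + 1 < e.2)
  (hX : ∀ c ∈ A, ∀ d ∈ A, ¬ Crosses c d)

theorem le_apex {e : ℕ × ℕ} {m : ℕ} (h1 : e.1 < m) (h2 : m < e.2)
    (h3 : m = e.1 + 1 ∨ (e.1, m) ∈ A) : m ≤ apex A e :=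
  Finset.le_sup (f := id) (Finset.mem_filter.2 ⟨Finset.mem_Ioo.2 ⟨h1, h2⟩, h3⟩)

include hA in
theorem apex_spec {e : ℕ × ℕ} (he : e ∈ A) :
    e.1 < apex A e ∧ apex A e < e.2 ∧ (apex A e = e.1 + 1 ∨ (e.1, apex A e) ∈ A) := by
  obtain ⟨m, hm, hm'⟩ := Finset.exists_mem_eq_sup
    ((Finset.Ioo e.1 e.2).filter (fun m => m = e.1 + 1 ∨ (e.1, m) ∈ A))
    ⟨e.1 + 1, by simpa using hA e he⟩ id
  rw [Finset.mem_filter, Finset.mem_Ioo] at hm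
  rw [apex, hm']
  exact ⟨hm.1.1, hm.1.2, hm.2⟩

include hX in
theorem nested_of_mem {c d : ℕ × ℕ} (hc : c ∈ A) (hd : d ∈ A) {m : ℕ} (h1 : c.1 < m)
    (h2 : m < c.2) (h3 : d.1 < m) (h4 : m < d.2) :
    (c.1 ≤ d.1 ∧ d.2 ≤ c.2) ∨ (d.1 ≤ c.1 ∧ c.2 ≤ d.2) := by
  have h5 := hX c hc d hd
  have h6 := hX d hd c hc
  simp only [Crosses] at h5 h6
  omega

include hA hX in
/-- An arc whose apex lies strictly below the arc `c` is nested in `c`. -/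
theorem nested_of_apex {c d : ℕ × ℕ} (hc : c ∈ A) (hd : d ∈ A) (h1 : c.1 < apex A d)
    (h2 : apex A d < c.2) : c.1 ≤ d.1 ∧ d.2 ≤ c.2 := by
  obtain ⟨h3, h4, h5⟩ := apex_spec hA hd
  rcases nested_of_mem hX hc hd h1 h2 h3 h4 with h | h
  · exact h
  rcases h.1.eq_or_lt with h6 | h6
  · rcases h.2.eq_or_lt with h7 | h7
    · omega
    · have := le_apex (A := A) (e := d) (m := c.2) (by omega) h7
        (Or.inr (by rw [h6]; exact hc))
      omega
  · rcases h5 with h5 | h5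
    · omega
    · exact absurd ⟨h6, h1, h2⟩ (hX _ h5 _ hc)

-- Arcs with a common apex are nested in each other, hence equal.
include hA hX in
theorem apex_injOn : Set.InjOn (apex A) A := by
  intro c hc d hd hcd
  have h1 := apex_spec hA hc
  have h2 := apex_spec hA hd
  have h3 := nested_of_apex hA hX hc hd (by omega) (by omega)
  have h4 := nested_of_apex hA hX hd hc (by omega) (by omega)
  exact Prod.ext (by omega) (by omega)

-- The apexes of the arcs in `B` are distinct and lie strictly between `u` and `w`.
include hA hX in
theorem card_le_of_nested {B : Finset (ℕ × ℕ)} (hB : B ⊆ A) {u w : ℕ}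
    (h : ∀ e ∈ B, u ≤ e.1 ∧ e.2 ≤ w) : B.card ≤ w - u - 1 := by
  rw [← Nat.card_Ioo]
  refine Finset.card_le_card_of_injOn (apex A) (fun e he => ?_)
    ((apex_injOn hA hX).mono (Finset.coe_subset.2 hB))
  have h1 := apex_spec hA (hB he)
  have h2 := h e he
  rw [Finset.mem_coe, Finset.mem_Ioo]
  omega

end Apex

theorem Dis.arcs {N i : ℕ} {T : Finset (ℕ × ℕ)} (hN : 3 ≤ N) (hT : T ∈ Dis N i) :
    (∀ e ∈ insert (1, N) T, 1 ≤ e.1 ∧ e.1 + 1 < e.2 ∧ e.2 ≤ N) ∧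
    (∀ c ∈ insert (1, N) T, ∀ d ∈ insert (1, N) T, ¬ Crosses c d) ∧
    (insert (1, N) T).card = i + 1 := by
  obtain ⟨h1, h2, h3⟩ := hT
  refine ⟨fun e he => ?_, fun c hc d hd => ?_, ?_⟩
  · rcases Finset.mem_insert.1 he with rfl | he
    · exact ⟨le_rfl, by omega, le_rfl⟩
    · exact ⟨(h1 e he).1, (h1 e he).2.1, (h1 e he).2.2.1⟩
  · rcases Finset.mem_insert.1 hc with rfl | hc <;> rcases Finset.mem_insert.1 hd with rfl | hd
    · rintro ⟨h4, h5, h6⟩; omega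
    · rintro ⟨h4, h5, h6⟩; have := (h1 _ hd).2.2.1; omega
    · rintro ⟨h4, h5, h6⟩; have := (h1 _ hc).1; omega
    · exact h2 c hc d hd
  · rw [Finset.card_insert_of_notMem, h3]
    exact fun h => (h1 _ h).2.2.2 ⟨rfl, rfl⟩

theorem sum_outDegree (N : ℕ) (T : Finset (ℕ × ℕ)) (v w : ℕ) :
    ∑ u ∈ Finset.Ico v w, outDegree N T u =
      ((insert (1, N) T).filter (fun e => v ≤ e.1 ∧ e.1 < w)).card := by
  rw [Finset.card_eq_sum_card_fiberwise (f := Prod.fst) (t := Finset.Ico v w)]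
  · refine Finset.sum_congr rfl fun u hu => ?_
    rw [Finset.mem_Ico] at hu
    rw [Finset.filter_filter, outDegree]
    congr 1
    refine Finset.filter_congr fun e _ => ?_
    omega
  · intro e he
    simp only [Finset.coe_filter, Set.mem_ofPred_eq] at he
    simpa using he.2

theorem height_outDegree_sub (N : ℕ) (T : Finset (ℕ × ℕ)) {v w : ℕ} (hv : 1 ≤ v) (hw : v ≤ w) :
    height (outDegree N T) w - height (outDegree N T) v =
      (((insert (1, N) T).filter (fun e => v ≤ e.1 ∧ e.1 < w)).card : ℤ) - ((w : ℤ) - v) := by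
  rw [height_sub _ hv hw, sum_outDegree]

section Triangulation

variable {N : ℕ} {T : Finset (ℕ × ℕ)} (hT : T ∈ Triangulations N)
include hT

/-- The `N - 2` arcs have distinct apexes among the `N - 2` vertices strictly between `1` and `N`,
so every such vertex occurs. -/
theorem Triangulations.exists_apex {m : ℕ} (h1 : 1 < m) (h2 : m < N) :
    ∃ e ∈ insert (1, N) T, apex (insert (1, N) T) e = m := by
  obtain ⟨hA, hX, hc⟩ := Dis.arcs hT.1 hT.2
  have hN := hT.1
  have hA' : ∀ e ∈ insert (1, N) T, e.1 + 1 < e.2 := fun e he => (hA e he).2.1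
  have h3 := Finset.surjOn_of_injOn_of_card_le (s := insert (1, N) T) (t := Finset.Ioo 1 N)
    (apex (insert (1, N) T)) (fun e he => by
      have h4 := apex_spec hA' he
      have h5 := hA e he
      rw [Finset.mem_coe, Finset.mem_Ioo]
      omega) (apex_injOn hA' hX) (by rw [hc, Nat.card_Ioo]; omega)
  exact h3 (by simpa using ⟨h1, h2⟩)

/-- Both height conditions are counts of arcs. For `u` strictly below `e`, the arcs starting in `[u,
e.2)` cannot cross `e`, so they are nested in `[u, e.2]` and number less than `e.2 - u`. On the
other hand, each vertex strictly below `e` is the apex of an arc nested in `e`, so at least `e.2 -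
e.1 - 1` arcs start in `[e.1, e.2)`. -/
theorem Triangulations.pathEdge {e : ℕ × ℕ} (he : e ∈ insert (1, N) T) :
    PathEdge (outDegree N T) e.1 e.2 := by
  obtain ⟨hA, hX, hc⟩ := Dis.arcs hT.1 hT.2
  have hA' : ∀ e ∈ insert (1, N) T, e.1 + 1 < e.2 := fun e he => (hA e he).2.1
  obtain ⟨h1, h2, h3⟩ := hA e he
  refine ⟨by omega, fun u h4 h5 => ?_, ?_⟩
  · have h6 := height_outDegree_sub N T (v := u) (w := e.2) (by omega) h5.le
    have h7 := card_le_of_nested hA' hX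
      (B := (insert (1, N) T).filter (fun d => u ≤ d.1 ∧ d.1 < e.2)) (u := u) (w := e.2)
      (Finset.filter_subset _ _) (fun d hd => by
        rw [Finset.mem_filter] at hd
        have := hX e he d hd.1
        simp only [Crosses] at this
        omega)
    omega
  · have h6 := height_outDegree_sub N T (v := e.1) (w := e.2) h1 (by omega)
    have h7 : (Finset.Ioo e.1 e.2).card ≤
        ((insert (1, N) T).filter (fun d => e.1 ≤ d.1 ∧ d.1 < e.2)).card := by
      refine Finset.card_le_card_of_surjOn (apex (insert (1, N) T)) fun m hm => ?_
      rw [Finset.mem_coe, Finset.mem_Ioo] at hm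
      obtain ⟨d, hd, rfl⟩ := exists_apex hT (m := m) (by omega) (by omega)
      have := nested_of_apex hA' hX he hd hm.1 hm.2
      refine ⟨d, ?_, rfl⟩
      rw [Finset.mem_coe, Finset.mem_filter]
      have := hA' d hd
      exact ⟨hd, by omega, by omega⟩
    rw [Nat.card_Ioo] at h7
    omega

theorem Triangulations.isLukasiewicz : IsLukasiewicz N (outDegree N T) := by
  obtain ⟨hA, hX, hc⟩ := Dis.arcs hT.1 hT.2
  have hN := hT.1
  have hlast : height (outDegree N T) N = -1 := by
    have h1 := height_outDegree_sub N T (v := 1) (w := N) le_rfl (by omega)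
    rw [Finset.filter_true_of_mem (fun e he => by have := hA e he; omega), hc, height_one] at h1
    omega
  refine ⟨fun u hu => ?_, fun v h1 h2 => ?_, hlast⟩
  · rw [outDegree, Finset.card_ne_zero] at hu
    obtain ⟨e, he⟩ := hu
    rw [Finset.mem_filter] at he
    have := hA e he.1
    omega
  · rcases h1.eq_or_lt with rfl | h1
    · rw [height_one]
    -- Since `(1, N)` is an edge of the path, every height strictly in between exceeds the final
    -- height `-1`.
    · have := (pathEdge hT (Finset.mem_insert_self (1, N) T)).2.1 v h1 h2
      simp only [hlast] at this
      omega

/-- Inclusion suffices, as both sides have `N - 3` chords. -/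
theorem Triangulations.eq_pathTri : T = pathTri N (outDegree N T) := by
  refine Finset.eq_of_subset_of_card_le (fun ⟨v, w⟩ he => ?_) ?_
  · have h1 := hT.2.1 _ he
    rw [mem_pathTri]
    exact ⟨h1.1, h1.2.2.1, h1.2.1, h1.2.2.2, pathEdge hT (Finset.mem_insert_of_mem he)⟩
  · rw [hT.2.2.2, ((isLukasiewicz hT).pathTri_mem hT.1).2.2.2]

end Triangulation

theorem IsLukasiewicz.outDegree_pathTri {N : ℕ} {o : ℕ → ℕ} (h : IsLukasiewicz N o)
    (hN : 3 ≤ N) : outDegree N (pathTri N o) = o :=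
  funext fun _ => h.card_arcs hN

/-! ### The fans of a triangulation -/

theorem mem_trianglesAt {N : ℕ} {T : Finset (ℕ × ℕ)} {a b : ℕ} {p : ℕ × ℕ} :
    p ∈ trianglesAt N T a b ↔ a < p.1 ∧ p.2 ≤ b ∧ p.1 < p.2 ∧ IsEdge N T a p.1 ∧
      IsEdge N T a p.2 ∧ IsEdge N T p.1 p.2 := by
  obtain ⟨x, y⟩ := p
  simp only [trianglesAt, List.mem_filter, List.pair_mem_product, List.mem_range'_1,
    decide_eq_true_eq]
  constructor
  · rintro ⟨h1, h2⟩; exact ⟨by omega, by omega, h2⟩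
  · rintro ⟨h1, h2, h3, h4⟩; exact ⟨by omega, h3, h4⟩

theorem pairwise_trianglesAt (N : ℕ) (T : Finset (ℕ × ℕ)) (a b : ℕ) :
    (trianglesAt N T a b).Pairwise (fun p q => p.1 < q.1 ∨ (p.1 = q.1 ∧ p.2 < q.2)) := by
  apply List.Pairwise.filter
  rw [List.product, List.pairwise_flatMap]
  refine ⟨fun x _ => ?_, ?_⟩
  · rw [List.pairwise_map]
    exact List.Pairwise.imp (fun h => Or.inr ⟨rfl, h⟩) (List.pairwise_lt_range' (s := a + 1))
  · refine List.Pairwise.imp (fun {x y} h p hp q hq => ?_) (List.pairwise_lt_range' (s := a + 1))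
    simp only [List.mem_map] at hp hq
    obtain ⟨_, _, rfl⟩ := hp
    obtain ⟨_, _, rfl⟩ := hq
    exact Or.inl h

namespace IsLukasiewicz

variable {N : ℕ} {o : ℕ → ℕ} (h : IsLukasiewicz N o)
include h

/-- Both lists are lexicographically increasing, so it is enough to compare their members. -/
theorem trianglesAt_pathTri {v : ℕ} (h1 : 1 ≤ v) (h2 : v < N) :
    trianglesAt N (pathTri N o) v (next o v) =
      (List.range (o v)).map (fun j => ((next o)^[j] (v + 1), (next o)^[j + 1] (v + 1))) := by
  have : Std.Antisymm (fun p q : ℕ × ℕ => p.1 < q.1 ∨ (p.1 = q.1 ∧ p.2 < q.2)) :=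
    ⟨fun a b _ _ => by omega⟩
  have : Std.Irrefl (fun p q : ℕ × ℕ => p.1 < q.1 ∨ (p.1 = q.1 ∧ p.2 < q.2)) :=
    ⟨fun a => by omega⟩
  refine (pairwise_trianglesAt _ _ _ _).eq_of_mem_iff ?_ ?_
  · rw [List.pairwise_map]
    refine List.Pairwise.imp_of_mem (fun {j k} hj hk hjk => Or.inl ?_) List.pairwise_lt_range
    rw [List.mem_range] at hk
    exact h.iterate_next_strictMono h1 h2 hjk hk.le
  · rintro ⟨x, y⟩
    simp only [mem_trianglesAt, List.mem_map, List.mem_range, Prod.mk.injEq]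
    have hn := h.next_le h1 h2
    constructor
    · rintro ⟨h3, h4, h5, h6, h7, h8⟩
      rw [h.isEdge_pathTri (by omega) (by omega) (by omega)] at h6 h7 h8
      obtain ⟨j, hj, rfl⟩ := (h.pathEdge_iff h1 h2).1 ⟨h6, by omega⟩
      obtain ⟨k, hk, rfl⟩ := (h.pathEdge_iff h1 h2).1 ⟨h7, by omega⟩
      have h9 := (h.iterate_next h1 h2 j hj).2.2
      have h10 := (h.iterate_next h1 h2 k hk).2.2
      have h11 := h8.2.2
      have h12 : j < k := by
        by_contra h12
        rcases (not_lt.mp h12).eq_or_lt with h13 | h13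
        · subst h13; omega
        · have := h.iterate_next_strictMono h1 h2 h13 hj; omega
      -- Heights fall by one per index, and an edge joining the two neighbours allows a fall of at
      -- most one.
      obtain rfl : k = j + 1 := by omega
      exact ⟨j, by omega, rfl, rfl⟩
    · rintro ⟨j, hj, rfl, rfl⟩
      obtain ⟨h3, h4, -⟩ := h.iterate_next h1 h2 j hj.le
      obtain ⟨h5, h6, -⟩ := h.iterate_next h1 h2 (j + 1) hj
      have h7 := h.iterate_next_strictMono h1 h2 (Nat.lt_add_one j) hj
      have h8 := h3.1
      refine ⟨h8, h.pathEdge_le_next h1 h2 h5 h6, h7, ?_, ?_, ?_⟩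
      · rwa [h.isEdge_pathTri h1 h8 h4]
      · rwa [h.isEdge_pathTri h1 h5.1 h6]
      · rw [h.isEdge_pathTri (by omega) h7 h6, Function.iterate_succ_apply']
        exact h.pathEdge_next (by omega) (by omega)

/-- The intervals between consecutive neighbours of `v` tile the interval that starts at `v + 1`. -/
theorem flatMap_filter_range' {v : ℕ} (h1 : 1 ≤ v) (h2 : v < N) (p : ℕ → Bool) (k : ℕ)
    (hk : k ≤ o v) :
    (List.range k).flatMap (fun j => (List.range' ((next o)^[j] (v + 1))
      ((next o)^[j + 1] (v + 1) - (next o)^[j] (v + 1))).filter p) =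
      (List.range' (v + 1) ((next o)^[k] (v + 1) - (v + 1))).filter p := by
  induction k with
  | zero => simp
  | succ k ih =>
    have h3 := (h.iterate_next h1 h2 k (by omega)).1.1
    have h4 := h.iterate_next_strictMono h1 h2 (Nat.lt_add_one k) hk
    rw [List.range_succ, List.flatMap_append, ih (by omega), List.flatMap_singleton,
      ← List.filter_append]
    congr 1
    have h5 : (next o)^[k + 1] (v + 1) - (v + 1) = ((next o)^[k] (v + 1) - (v + 1)) +
        ((next o)^[k + 1] (v + 1) - (next o)^[k] (v + 1)) := by
      have := h4.le
      omega
    rw [h5, ← List.range'_append_1]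
    congr 2
    omega

/-- Parts of the form `v, …, next o v` are stable under the recursion: the side opposite to `v` in a
triangle joins some `w` to `next o w`. These smaller parts follow one another from left to right, so
the origins appear in increasing order. The bound `k` on the length drives the induction. -/
theorem fansBetween_pathTri (k : ℕ) : ∀ v, 1 ≤ v → v < N → next o v - v ≤ k →
    fansBetween N (pathTri N o) v (next o v) =
      ((List.range' v (next o v - v)).filter (fun u => o u ≠ 0)).map
        (fun u => ⟨u, trianglesAt N (pathTri N o) u (next o u)⟩) := by
  induction k with
  | zero => intro v h1 h2 h3; have := h.lt_next h1 h2; omega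
  | succ k ih =>
    intro v h1 h2 h3
    have h4 := h.lt_next h1 h2
    rw [fansBetween]
    by_cases h0 : o v = 0
    · rw [(h.next_eq_succ_iff h1 h2).2 h0]
      simp [h0]
    · have h5 : v + 1 < next o v := by
        have := (h.next_eq_succ_iff h1 h2).not.2 h0
        omega
      have h6 : next o v - v = (next o v - (v + 1)) + 1 := by omega
      rw [if_pos h5, h6, List.range'_succ, List.filter_cons_of_pos (by simpa using h0),
        List.map_cons]
      congr 1
      have hf := h.flatMap_filter_range' h1 h2 (fun u => o u ≠ 0) (o v) le_rfl
      rw [h.iterate_next_apply h1 h2] at hf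
      rw [← hf, List.map_flatMap]
      have hsub := List.flatMap_subtype (l := (trianglesAt N (pathTri N o) v (next o v)).attach)
        (f := fun p => fansBetween N (pathTri N o) p.1.1 p.1.2)
        (g := fun p => fansBetween N (pathTri N o) p.1 p.2) (fun _ _ => rfl)
      rw [hsub, List.unattach_attach, h.trianglesAt_pathTri h1 h2, List.flatMap_map]
      refine List.flatMap_congr fun j hj => ?_
      rw [List.mem_range] at hj
      obtain ⟨h7, h8, -⟩ := h.iterate_next h1 h2 j hj.le
      obtain ⟨h9, h10, -⟩ := h.iterate_next h1 h2 (j + 1) hj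
      have h11 := h.iterate_next_strictMono h1 h2 (Nat.lt_add_one j) hj
      have h12 := h.pathEdge_le_next h1 h2 h9 h10
      have h13 := h7.1
      simp only [Function.iterate_succ_apply'] at h10 h11 h12 ⊢
      exact ih _ (by omega) (by omega) (by omega)

theorem fans_pathTri : fans N (pathTri N o) =
    ((List.range' 1 (N - 1)).filter (fun u => o u ≠ 0)).map
      (fun u => ⟨u, trianglesAt N (pathTri N o) u (next o u)⟩) := by
  have := h.fansBetween_pathTri _ 1 le_rfl h.two_le le_rfl
  rwa [h.next_one] at this

end IsLukasiewicz

/-- The positions of the non-zero steps. -/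
def peaks (N : ℕ) (o : ℕ → ℕ) : List ℕ := (List.range' 1 (N - 1)).filter (fun u => o u ≠ 0)

theorem mem_peaks {N : ℕ} {o : ℕ → ℕ} (h : IsLukasiewicz N o) {v : ℕ} :
    v ∈ peaks N o ↔ o v ≠ 0 := by
  simp only [peaks, List.mem_filter, List.mem_range'_1, decide_eq_true_eq]
  refine ⟨fun h1 => h1.2, fun h1 => ⟨?_, h1⟩⟩
  have := h.support v h1
  omega

theorem sortedLT_peaks (N : ℕ) (o : ℕ → ℕ) : (peaks N o).SortedLT :=
  (List.Pairwise.filter _ List.pairwise_lt_range').sortedLT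

theorem fanOrigins_pathTri {N : ℕ} {o : ℕ → ℕ} (h : IsLukasiewicz N o) :
    fanOrigins N (pathTri N o) = peaks N o := by
  rw [fanOrigins, h.fans_pathTri, List.map_map]
  exact List.map_id _

theorem fanSizes_pathTri {N : ℕ} {o : ℕ → ℕ} (h : IsLukasiewicz N o) :
    fanSizes N (pathTri N o) = (peaks N o).map o := by
  rw [fanSizes, h.fans_pathTri, List.map_map]
  refine List.map_congr_left fun u hu => ?_
  have := h.support u ((mem_peaks h).1 hu)
  simp [Fan.size, h.trianglesAt_pathTri this.1 this.2]

/-- The Łukasiewicz sequences with `k` non-zero terms, all at least `2`. -/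
def LukSeq (N k : ℕ) : Set (ℕ → ℕ) :=
  {o | IsLukasiewicz N o ∧ (∀ v, o v ≠ 1) ∧ (peaks N o).length = k}

/-- With no singular fans allowed, the condition on the last fan is automatic. -/
theorem mem_Tri_iff {N k : ℕ} (hN : 3 ≤ N) {o : ℕ → ℕ} (h : IsLukasiewicz N o) :
    pathTri N o ∈ Tri N k 0 ↔ o ∈ LukSeq N k := by
  have h1 : (fans N (pathTri N o)).length = (peaks N o).length := by
    rw [← fanOrigins_pathTri h, fanOrigins, List.length_map]
  have h2 : (∀ F ∈ fans N (pathTri N o), F.size ≠ 1) ↔ ∀ v, o v ≠ 1 := by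
    have h3 : (∀ s ∈ fanSizes N (pathTri N o), s ≠ 1) ↔ ∀ v, o v ≠ 1 := by
      rw [fanSizes_pathTri h, List.forall_mem_map]
      refine ⟨fun h3 v h4 => h3 v ((mem_peaks h).2 (by omega)) h4, fun h3 v _ => h3 v⟩
    rw [← h3, fanSizes, List.forall_mem_map]
  simp only [Tri, LukSeq, Set.mem_ofPred_eq, zero_add, List.countP_eq_zero, decide_eq_true_eq]
  rw [h1, h2]
  constructor
  · rintro ⟨-, h3, h4, -⟩
    exact ⟨h, h4, h3⟩
  · rintro ⟨-, h4, h3⟩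
    exact ⟨h.pathTri_mem hN, h3, h4, fun F hF => h2.2 h4 F (List.mem_of_getLast? hF)⟩

theorem bijOn_pathTri {N : ℕ} (hN : 3 ≤ N) (k : ℕ) :
    Set.BijOn (pathTri N) (LukSeq N k) (Tri N k 0) := by
  refine ⟨fun o ho => (mem_Tri_iff hN ho.1).2 ho, fun o ho o' ho' hoo => ?_, fun T hT => ?_⟩
  · rw [← ho.1.outDegree_pathTri hN, hoo, ho'.1.outDegree_pathTri hN]
  · have h1 := Triangulations.eq_pathTri hT.1
    refine ⟨outDegree N T, ?_, h1.symm⟩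
    rw [h1] at hT
    exact (mem_Tri_iff hN (Triangulations.isLukasiewicz (by rw [h1]; exact hT.1))).1 hT

open DyckStep

/-! ### Words of Łukasiewicz sequences -/

/-- The word with exactly `k` up steps before its successive down steps, for `k` in `l`. -/
def lukWord (l : List ℕ) : List DyckStep := l.flatMap (fun k => List.replicate k U ++ [D])

/-- The word `U^{u₁} D^{d₁} ⋯` of a sequence with non-zero steps `u₁, …` at distances `d₁, …`. -/
def pathWord (N : ℕ) (o : ℕ → ℕ) : List DyckStep :=
  upDownWord ((peaks N o).map o) (diffs (peaks N o) ++ [N + 1 - (peaks N o).getLastD 0 - 2])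

theorem triWord_pathTri {N : ℕ} {o : ℕ → ℕ} (h : IsLukasiewicz N o) :
    triWord N (pathTri N o) = pathWord N o := by
  rw [triWord, fanSizes_pathTri h, fanOrigins_pathTri h, pathWord]

theorem lukWord_cons (k : ℕ) (l : List ℕ) :
    lukWord (k :: l) = List.replicate k U ++ D :: lukWord l := by
  simp [lukWord]

theorem lukWord_append (l l' : List ℕ) : lukWord (l ++ l') = lukWord l ++ lukWord l' := by
  simp [lukWord]

theorem count_U_lukWord (l : List ℕ) : (lukWord l).count U = l.sum := by
  induction l with
  | nil => rfl
  | cons k l ih => simp [lukWord_cons, ih, List.count_replicate_self]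

theorem count_D_lukWord (l : List ℕ) : (lukWord l).count D = l.length := by
  induction l with
  | nil => rfl
  | cons k l ih => simp [lukWord_cons, ih, List.count_replicate]

theorem exists_eq_lukWord (w : List DyckStep) :
    ∃ l r, w = lukWord l ++ List.replicate r U := by
  induction w using List.reverseRecOn with
  | nil => exact ⟨[], 0, rfl⟩
  | append_singleton w s ih =>
    obtain ⟨l, r, rfl⟩ := ih
    rcases s with _ | _
    · exact ⟨l, r + 1, by rw [List.append_assoc, List.replicate_succ']⟩
    · exact ⟨l ++ [r], 0, by simp [lukWord]⟩

theorem replicate_append_D_inj {j k : ℕ} {w w' : List DyckStep}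
    (h : List.replicate j U ++ D :: w = List.replicate k U ++ D :: w') : j = k ∧ w = w' := by
  induction j generalizing k with
  | zero => cases k <;> simp_all [List.replicate_succ]
  | succ j ih =>
    cases k with
    | zero => simp_all [List.replicate_succ]
    | succ k =>
      simp only [List.replicate_succ, List.cons_append, List.cons.injEq, true_and] at h
      have := ih h
      exact ⟨by rw [this.1], this.2⟩

/-- A prefix that is empty or ends in a down step cuts the word between two blocks `U^k D`. -/
theorem eq_append_of_lukWord_append {l l' : List ℕ} {s : List DyckStep}
    (h : lukWord l' ++ s = lukWord l) : ∃ l'', l = l' ++ l'' ∧ s = lukWord l'' := by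
  induction l' generalizing l with
  | nil => exact ⟨l, rfl, h⟩
  | cons k l' ih =>
    cases l with
    | nil => simp [lukWord] at h
    | cons j l =>
      rw [lukWord_cons, lukWord_cons, List.append_assoc, List.cons_append] at h
      obtain ⟨rfl, h2⟩ := replicate_append_D_inj h
      obtain ⟨l'', rfl, h3⟩ := ih h2
      exact ⟨l'', rfl, h3⟩

theorem lukWord_injective : Function.Injective lukWord := by
  intro l l' h
  obtain ⟨l'', rfl, h2⟩ := eq_append_of_lukWord_append ((List.append_nil _).trans h)
  cases l'' with
  | nil => simp
  | cons => simp [lukWord] at h2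

theorem exists_replicate_D_append (w : List DyckStep) :
    ∃ e w', w = List.replicate e D ++ w' ∧ w'.head? ≠ some D := by
  induction w with
  | nil => exact ⟨0, [], rfl, by simp⟩
  | cons s w ih =>
    rcases s with _ | _
    · exact ⟨0, U :: w, rfl, by simp⟩
    · obtain ⟨e, w', rfl, h⟩ := ih
      exact ⟨e + 1, w', by simp [List.replicate_succ], h⟩

theorem splitBy_replicate_append (s : DyckStep) (k : ℕ) {w : List DyckStep}
    (h : w.head? ≠ some s) :
    (List.replicate (k + 1) s ++ w).splitBy (fun x y => x == y) =
      List.replicate (k + 1) s :: w.splitBy (fun x y => x == y) := by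
  rw [List.splitBy_append, List.splitBy_of_isChain (by simp), List.singleton_append]
  · exact List.isChain_replicate_of_rel _ (beq_self_eq_true s)
  · intro x hx y hy
    rw [List.getLast?_replicate] at hx
    simp only [Nat.add_eq_zero_iff, one_ne_zero, and_false, if_false, Option.mem_def,
      Option.some.injEq] at hx
    subst hx
    rw [beq_eq_false_iff_ne]
    rintro rfl
    exact h hy

theorem ascents_replicate_D_append (e : ℕ) {w : List DyckStep} (h : w.head? ≠ some D) :
    ascents (List.replicate e D ++ w) = ascents w := by
  cases e with
  | zero => rfl
  | succ e =>
    rw [ascents, splitBy_replicate_append D e h, List.filter_cons_of_neg]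
    · rfl
    · simp [List.replicate_succ]

theorem ascents_D_cons (w : List DyckStep) : ascents (D :: w) = ascents w := by
  obtain ⟨e, w', rfl, h⟩ := exists_replicate_D_append w
  rw [ascents_replicate_D_append e h, ← ascents_replicate_D_append (e + 1) h]
  rfl

theorem ascents_lukWord (l : List ℕ) : ascents (lukWord l) = l.filter (· ≠ 0) := by
  induction l with
  | nil => rfl
  | cons k l ih =>
    rw [lukWord_cons]
    cases k with
    | zero => simpa [ascents_D_cons] using ih
    | succ k =>
      rw [ascents, splitBy_replicate_append U k (by simp), List.filter_cons_of_pos,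
        List.map_cons, List.length_replicate, List.filter_cons_of_pos (by simp), ← ih,
        ← ascents_D_cons (lukWord l)]
      · rfl
      · simp [List.replicate_succ]

/-- This matches the encoding by single down steps with the encoding by runs: zeros merely lengthen
the preceding run of down steps, and those before the first non-zero term form a leading run. If all
terms vanish, the default `a + k` makes that run have length `k`; the default `0` of the last entry
is then irrelevant, since `upDownWord` is empty. -/
theorem lukWord_map_range' (o : ℕ → ℕ) (k : ℕ) : ∀ a, lukWord ((List.range' a k).map o) =
    List.replicate (((List.range' a k).filter (fun u => o u ≠ 0)).headD (a + k) - a) D ++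
      upDownWord (((List.range' a k).filter (fun u => o u ≠ 0)).map o)
        (diffs ((List.range' a k).filter (fun u => o u ≠ 0)) ++
          [a + k - ((List.range' a k).filter (fun u => o u ≠ 0)).getLastD 0]) := by
  induction k with
  | zero => intro a; simp [lukWord, upDownWord]
  | succ k ih =>
    intro a
    rw [List.range'_succ, List.map_cons, lukWord_cons, ih (a + 1)]
    have hmem : ∀ v ∈ (List.range' (a + 1) k).filter (fun u => o u ≠ 0), a + 1 ≤ v := by
      intro v hv
      simp only [List.mem_filter, List.mem_range'_1] at hv
      omega
    have hak : a + 1 + k = a + (k + 1) := by omega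
    rw [hak]
    by_cases h0 : o a = 0
    · rw [List.filter_cons_of_neg (by simpa using h0), h0]
      generalize (List.range' (a + 1) k).filter (fun u => o u ≠ 0) = Z at hmem
      have : Z.headD (a + (k + 1)) - a = (Z.headD (a + (k + 1)) - (a + 1)) + 1 := by
        cases Z with
        | nil => simp only [List.headD_nil]; omega
        | cons z Z => have := hmem z (by simp); simp only [List.headD_cons]; omega
      rw [this, List.replicate_succ]
      rfl
    · rw [List.filter_cons_of_pos (by simpa using h0)]
      generalize (List.range' (a + 1) k).filter (fun u => o u ≠ 0) = Z at hmem
      rw [List.headD_cons, Nat.sub_self]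
      cases Z with
      | nil =>
        have : a + (k + 1) - a = (a + (k + 1) - (a + 1)) + 1 := by omega
        simp [upDownWord, diffs, this, List.replicate_succ]
      | cons z Z =>
        have := hmem z (by simp)
        have : z - a = (z - (a + 1)) + 1 := by omega
        simp [upDownWord, diffs, this, List.replicate_succ]

theorem sum_map_range' (o : ℕ → ℕ) (j : ℕ) :
    ((List.range' 1 j).map o).sum = ∑ u ∈ Finset.Ico 1 (j + 1), o u := by
  induction j with
  | zero => rfl
  | succ j ih =>
    rw [List.range'_1_concat, List.map_append, List.sum_append, ih,
      Finset.sum_Ico_succ_top (b := j + 1) (by omega), add_comm 1 j]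
    simp

namespace IsLukasiewicz

variable {N : ℕ} {o : ℕ → ℕ} (h : IsLukasiewicz N o)
include h

/-- The path can reach `-1` only by a down step from height `0`. -/
theorem apply_pred : o (N - 1) = 0 := by
  have h2 := h.two_le
  have h1 := height_succ o (v := N - 1) (by omega)
  have h3 := h.nonneg (N - 1) (by omega) (by omega)
  rw [Nat.sub_add_cancel (by omega), h.last] at h1
  omega

theorem apply_one (hN : 3 ≤ N) : o 1 ≠ 0 := by
  have h1 := height_succ o (v := 1) le_rfl
  have h3 := h.nonneg 2 (by omega) (by omega)
  rw [height_one] at h1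
  simp only [Nat.reduceAdd] at h1
  omega

theorem peaks_eq : peaks N o = (List.range' 1 (N - 2)).filter (fun u => o u ≠ 0) := by
  have h2 := h.two_le
  have h3 : N - 1 = (N - 2) + 1 := by omega
  have h4 := h.apply_pred
  rw [peaks, h3, List.range'_1_concat, List.filter_append]
  rw [h3, add_comm] at h4
  simp [h4]

theorem peaks_head (hN : 3 ≤ N) : ∃ Z, peaks N o = 1 :: Z := by
  have h3 : N - 1 = (N - 2) + 1 := by omega
  rw [peaks, h3, List.range'_succ, List.filter_cons_of_pos (by simpa using h.apply_one hN)]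
  exact ⟨_, rfl⟩

/-- Vertex `1` is a peak, so there is no leading run of down steps. The "minus `2`" in the last
exponent reflects that only `N - 2` terms are recorded. -/
theorem pathWord_eq (hN : 3 ≤ N) : pathWord N o = lukWord ((List.range' 1 (N - 2)).map o) := by
  rw [lukWord_map_range', ← h.peaks_eq, pathWord]
  obtain ⟨Z, hZ⟩ := h.peaks_head hN
  have : N + 1 - (peaks N o).getLastD 0 - 2 = 1 + (N - 2) - (peaks N o).getLastD 0 := by omega
  rw [this]
  simp [hZ]

theorem ascents_pathWord (hN : 3 ≤ N) : ascents (pathWord N o) = (peaks N o).map o := by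
  rw [h.pathWord_eq hN, ascents_lukWord, h.peaks_eq, List.filter_map]
  rfl

end IsLukasiewicz

/-- With the forced zero at `N - 1` dropped, this is the ballot condition on Dyck words, tested
right after each down step. -/
theorem isLukasiewicz_iff {N : ℕ} (hN : 3 ≤ N) {o : ℕ → ℕ} :
    IsLukasiewicz N o ↔ (∀ u, o u ≠ 0 → 1 ≤ u ∧ u ≤ N - 2) ∧
      (∀ j ≤ N - 2, j ≤ (((List.range' 1 (N - 2)).map o).take j).sum) ∧
      ((List.range' 1 (N - 2)).map o).sum = N - 2 := by
  have key : ∀ j ≤ N - 2, ((((List.range' 1 (N - 2)).map o).take j).sum : ℤ) =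
      height o (j + 1) + j := by
    intro j hj
    rw [← List.map_take, List.take_range'_of_length_ge hj, sum_map_range',
      height_eq _ (by omega)]
    push_cast
    ring
  have hsum : (((List.range' 1 (N - 2)).map o).sum : ℤ) = height o (N - 1) + (N - 2) := by
    have := key (N - 2) le_rfl
    rw [List.take_of_length_le (by simp)] at this
    rw [this, show N - 2 + 1 = N - 1 by omega, Nat.cast_sub (by omega)]
    rfl
  have hlast := height_succ o (v := N - 1) (by omega)
  rw [Nat.sub_add_cancel (by omega)] at hlast
  constructor
  · intro h
    have h0 := h.apply_pred
    refine ⟨fun u hu => ?_, fun j hj => ?_, ?_⟩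
    · have h1 := h.support u hu
      have h2 : u ≠ N - 1 := by rintro rfl; exact hu h0
      omega
    · have := key j hj
      have := h.nonneg (j + 1) (by omega) (by omega)
      omega
    · rw [h.last, h0] at hlast
      omega
  · rintro ⟨h1, h2, h3⟩
    have h4 : o (N - 1) = 0 := by
      by_contra h4
      have := h1 _ h4
      omega
    refine ⟨fun u hu => by have := h1 u hu; omega, fun v hv1 hv2 => ?_, ?_⟩
    · have h5 := key (v - 1) (by omega)
      have h6 := h2 (v - 1) (by omega)
      rw [Nat.sub_add_cancel hv1] at h5
      omega
    · omega

theorem toList_mem_Dyck {p : DyckWord} {m k : ℕ} (h : p ∈ Dyck m k 0) :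
    p.toList.count U = m ∧ (∀ x ∈ ascents p.toList, x ≠ 1) ∧
      (ascents p.toList).countP (fun x => decide (2 ≤ x)) = k := by
  obtain ⟨h1, h2, h3, -⟩ := h
  rw [List.count_eq_zero] at h3
  exact ⟨h1, fun x hx hx1 => h3 (hx1 ▸ hx), h2⟩

theorem countP_map_peaks {N : ℕ} {o : ℕ → ℕ} (h : IsLukasiewicz N o) (h1 : ∀ v, o v ≠ 1) :
    ((peaks N o).map o).countP (fun x => decide (2 ≤ x)) = (peaks N o).length := by
  rw [List.countP_eq_length.2, List.length_map]
  intro x hx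
  obtain ⟨v, hv, rfl⟩ := List.mem_map.1 hx
  have := (mem_peaks h).1 hv
  have := h1 v
  simp only [decide_eq_true_eq]
  omega

theorem exists_dyckWord {N k : ℕ} (hN : 3 ≤ N) {o : ℕ → ℕ} (ho : o ∈ LukSeq N k) :
    ∃ p ∈ Dyck (N - 2) k 0, p.toList = pathWord N o := by
  obtain ⟨h, h1, h2⟩ := ho
  have h3 := (isLukasiewicz_iff hN).1 h
  have hne : ∀ x ∈ ascents (pathWord N o), x ≠ 1 := by
    rw [h.ascents_pathWord hN, List.forall_mem_map]
    exact fun v _ => h1 v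
  have hU : (pathWord N o).count U = N - 2 := by
    rw [h.pathWord_eq hN, count_U_lukWord, h3.2.2]
  refine ⟨⟨pathWord N o, ?_, fun i => ?_⟩, ⟨hU, ?_, ?_, ?_⟩, rfl⟩
  · rw [hU, h.pathWord_eq hN, count_D_lukWord]
    simp
  -- A prefix consists of complete blocks followed by up steps, so the worst case is directly after
  -- a down step.
  · obtain ⟨l, r, hl⟩ := exists_eq_lukWord ((pathWord N o).take i)
    have h4 := List.take_append_drop i (pathWord N o)
    rw [hl, h.pathWord_eq hN, List.append_assoc] at h4
    obtain ⟨l', h5, -⟩ := eq_append_of_lukWord_append h4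
    have h6 : l.length ≤ N - 2 := by
      have := congrArg List.length h5
      simp only [List.length_map, List.length_range', List.length_append] at this
      omega
    have h7 := h3.2.1 l.length h6
    rw [h5, List.take_left] at h7
    rw [hl, List.count_append, List.count_append, count_D_lukWord, count_U_lukWord,
      List.count_replicate_self]
    simp only [List.count_replicate]
    simp
    omega
  · change (ascents (pathWord N o)).countP _ = k
    rw [h.ascents_pathWord hN, countP_map_peaks h h1, h2]
  · exact List.count_eq_zero.2 fun hx => hne 1 hx rfl
  · intro before m after hb _ _ hx
    exact hne 1 (by change ascents (pathWord N o) = _ at hb; rw [hb]; simp [hx]) rfl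

theorem exists_lukSeq {N k : ℕ} (hN : 3 ≤ N) {p : DyckWord} (hp : p ∈ Dyck (N - 2) k 0) :
    ∃ o ∈ LukSeq N k, p.toList = pathWord N o := by
  obtain ⟨h1, h2, h3⟩ := toList_mem_Dyck hp
  obtain ⟨l, r, hl⟩ := exists_eq_lukWord p.toList
  have hpre : ∀ w, w <+: p.toList → w.count D ≤ w.count U := by
    intro w hw
    rw [List.prefix_iff_eq_take.1 hw]
    exact p.count_D_le_count_U _
  have h4 := hpre (lukWord l) ⟨_, hl.symm⟩
  have h5 := p.count_U_eq_count_D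
  rw [hl, List.count_append, List.count_append, List.count_replicate_self] at h5
  have h6 : (List.replicate r U).count D = 0 := by simp [List.count_replicate]
  rw [count_D_lukWord, count_U_lukWord] at h4 h5
  -- Already the part `lukWord l` has at least as many up steps as down steps, so a balanced word
  -- has no trailing up steps.
  obtain rfl : r = 0 := by omega
  rw [List.replicate_zero, List.append_nil] at hl
  rw [hl, count_U_lukWord] at h1
  have hlen : l.length = N - 2 := by simp at h5; omega
  set o : ℕ → ℕ := fun v => if v = 0 then 0 else l.getD (v - 1) 0 with ho
  have hmap : (List.range' 1 (N - 2)).map o = l := by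
    apply List.ext_getElem
    · simp [hlen]
    · intro i h7 h8
      simp [ho, h8, Nat.add_comm 1 i]
  have hluk : IsLukasiewicz N o := by
    rw [isLukasiewicz_iff hN, hmap]
    refine ⟨fun u hu => ?_, fun j hj => ?_, h1⟩
    · simp only [ho] at hu
      split_ifs at hu with h7
      · exact absurd rfl hu
      refine ⟨by omega, ?_⟩
      by_contra h8
      exact hu (List.getD_eq_default _ _ (by omega))
    · have h7 := hpre (lukWord (l.take j)) (by
        rw [hl]
        conv_rhs => rw [← List.take_append_drop j l, lukWord_append]
        exact List.prefix_append _ _)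
      rw [count_D_lukWord, count_U_lukWord, List.length_take] at h7
      omega
  have hw : p.toList = pathWord N o := by rw [hluk.pathWord_eq hN, hmap, hl]
  rw [hw, hluk.ascents_pathWord hN] at h2 h3
  have hne : ∀ v, o v ≠ 1 := fun v hv => (List.forall_mem_map.1 h2) v
    ((mem_peaks hluk).2 (by omega)) hv
  exact ⟨o, ⟨hluk, hne, by rw [← h3, countP_map_peaks hluk hne]⟩, hw⟩

theorem bijOn_pathWord {N : ℕ} (hN : 3 ≤ N) (k : ℕ) :
    Set.BijOn (pathWord N) (LukSeq N k) (DyckWord.toList '' Dyck (N - 2) k 0) := by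
  refine ⟨fun o ho => exists_dyckWord hN ho, fun o ho o' ho' hoo => ?_, ?_⟩
  · rw [ho.1.pathWord_eq hN, ho'.1.pathWord_eq hN] at hoo
    have h1 := List.map_inj_left.1 (lukWord_injective hoo)
    have h2 := ((isLukasiewicz_iff hN).1 ho.1).1
    have h3 := ((isLukasiewicz_iff hN).1 ho'.1).1
    funext v
    by_cases hv : 1 ≤ v ∧ v ≤ N - 2
    · exact h1 v (by rw [List.mem_range'_1]; omega)
    · rw [not_imp_comm.1 (h2 v) hv, not_imp_comm.1 (h3 v) hv]
  · rintro _ ⟨p, hp, rfl⟩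
    obtain ⟨o, ho, h⟩ := exists_lukSeq hN hp
    exact ⟨o, ho, h.symm⟩

/-! ### Contraction and expansion -/

/-- The label of the vertex `v` after the contraction of the sides behind the non-zero steps. -/
def flats (o : ℕ → ℕ) (v : ℕ) : ℕ := 1 + ((Finset.Ico 1 v).filter (fun x => o x = 0)).card

theorem flats_one (o : ℕ → ℕ) : flats o 1 = 1 := by simp [flats]

theorem flats_add (o : ℕ → ℕ) {v w : ℕ} (hv : 1 ≤ v) (hw : v ≤ w) :
    flats o w = flats o v + ((Finset.Ico v w).filter (fun x => o x = 0)).card := by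
  rw [flats, flats, ← Finset.Ico_union_Ico_eq_Ico hv hw, Finset.filter_union,
    Finset.card_union_of_disjoint, add_assoc]
  exact Finset.disjoint_filter_filter (Finset.Ico_disjoint_Ico_consecutive 1 v w)

theorem flats_le {o : ℕ → ℕ} {v w : ℕ} (hv : 1 ≤ v) (hw : v ≤ w) : flats o v ≤ flats o w := by
  rw [flats_add o hv hw]; omega

theorem flats_lt {o : ℕ → ℕ} {v x w : ℕ} (hv : 1 ≤ v) (hx : v ≤ x) (hw : x < w) (h0 : o x = 0) :
    flats o v < flats o w := by
  rw [flats_add o hv (by omega : v ≤ w), Nat.lt_add_right_iff_pos, Finset.card_pos]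
  exact ⟨x, by simp [hx, hw, h0]⟩

theorem lt_of_flats_lt {o : ℕ → ℕ} {v w : ℕ} (hw : 1 ≤ w) (h : flats o v < flats o w) :
    v < w := by
  by_contra hc
  have := flats_le (o := o) hw (not_lt.mp hc)
  omega

theorem flats_add_card {N : ℕ} {o : ℕ → ℕ} (h : IsLukasiewicz N o) {v : ℕ} (hv : 1 ≤ v) :
    flats o v + ((peaks N o).toFinset.filter (· < v)).card = v := by
  have h1 : (peaks N o).toFinset.filter (· < v) = (Finset.Ico 1 v).filter (fun x => ¬ o x = 0) := by
    ext x
    simp only [Finset.mem_filter, List.mem_toFinset, mem_peaks h, Finset.mem_Ico]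
    have := h.support x
    tauto
  rw [h1, flats, add_assoc, Finset.card_filter_add_card_filter_not, Nat.card_Ico]
  omega

theorem contractVertex_pathTri {N : ℕ} {o : ℕ → ℕ} (h : IsLukasiewicz N o) {v : ℕ} (hv : 1 ≤ v) :
    contractVertex N (pathTri N o) v = flats o v := by
  rw [contractVertex, fanOrigins_pathTri h]
  have := flats_add_card h hv
  omega

theorem mem_foldr_union {α : Type*} [DecidableEq α] (L : List (Finset α)) (c : α) :
    c ∈ L.foldr (fun A B => A ∪ B) ∅ ↔ ∃ A ∈ L, c ∈ A := by
  induction L with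
  | nil => simp
  | cons A L ih => simp [ih]

namespace IsLukasiewicz

variable {N : ℕ} {o : ℕ → ℕ} (h : IsLukasiewicz N o)
include h

theorem iterate_next_inj {v : ℕ} (h1 : 1 ≤ v) (h2 : v < N) {j k : ℕ} (hj : j ≤ o v)
    (hk : k ≤ o v) (hjk : (next o)^[j] (v + 1) = (next o)^[k] (v + 1)) : j = k := by
  by_contra hne
  rcases lt_or_gt_of_ne hne with h3 | h3
  · exact absurd hjk (h.iterate_next_strictMono h1 h2 h3 hk).ne
  · exact absurd hjk (h.iterate_next_strictMono h1 h2 h3 hj).ne'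

theorem mem_internalDiagonals {v : ℕ} (h1 : 1 ≤ v) (h2 : v < N) {c : ℕ × ℕ} :
    c ∈ (Fan.mk v (trianglesAt N (pathTri N o) v (next o v))).internalDiagonals ↔
      c.1 = v ∧ ∃ j, 1 ≤ j ∧ j < o v ∧ c.2 = (next o)^[j] (v + 1) := by
  obtain ⟨a, b⟩ := c
  simp only [Fan.internalDiagonals, h.trianglesAt_pathTri h1 h2, List.map_map, Finset.mem_image,
    Finset.mem_inter, List.mem_toFinset, List.mem_map, List.mem_range, Function.comp_apply,
    Prod.mk.injEq]
  constructor
  · rintro ⟨w, ⟨⟨j, hj, rfl⟩, k, hk, hjk⟩, rfl, rfl⟩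
    obtain rfl := h.iterate_next_inj h1 h2 hk.le (show j + 1 ≤ o v from hj) hjk
    exact ⟨rfl, j + 1, by omega, hk, rfl⟩
  · rintro ⟨rfl, j, hj1, hj2, rfl⟩
    exact ⟨_, ⟨⟨j - 1, by omega, by rw [Nat.sub_add_cancel hj1]⟩, j, hj2, rfl⟩, rfl, rfl⟩

theorem mem_pathTri_iff {v w : ℕ} : (v, w) ∈ pathTri N o ↔
    1 ≤ v ∧ v < N ∧ ¬ (v = 1 ∧ w = N) ∧ ∃ j, 1 ≤ j ∧ j ≤ o v ∧ w = (next o)^[j] (v + 1) := by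
  rw [mem_pathTri]
  constructor
  · rintro ⟨h1, h2, h3, h4, h5⟩
    obtain ⟨j, hj, rfl⟩ := (h.pathEdge_iff h1 (by omega)).1 ⟨h5, h2⟩
    refine ⟨h1, by omega, h4, j, ?_, hj, rfl⟩
    rcases j with _ | j
    · simp at h3
    · omega
  · rintro ⟨h1, h2, h4, j, hj1, hj2, rfl⟩
    obtain ⟨h5, h6, -⟩ := h.iterate_next h1 h2 j hj2
    have h7 := h.iterate_next_strictMono h1 h2 (j := 0) hj1 hj2
    exact ⟨h1, h6, by simpa using h7, h4, h5⟩

/-- The chords that survive the removal of the internal diagonals of the fans. -/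
theorem pathTri_sdiff_internalDiagonals :
    pathTri N o \ ((fans N (pathTri N o)).map Fan.internalDiagonals).foldr (fun A B => A ∪ B) ∅ =
      ((peaks N o).toFinset.erase 1).image (fun v => (v, next o v)) := by
  have hf : fans N (pathTri N o) = (peaks N o).map
    (fun u => ⟨u, trianglesAt N (pathTri N o) u (next o u)⟩) := h.fans_pathTri
  ext ⟨v, w⟩
  simp only [Finset.mem_sdiff, mem_foldr_union, hf, List.mem_map, Finset.mem_image,
    Finset.mem_erase, List.mem_toFinset, mem_peaks h, Prod.mk.injEq]
  constructor
  · rintro ⟨h1, h2⟩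
    obtain ⟨h3, h4, h5, j, hj1, hj2, rfl⟩ := h.mem_pathTri_iff.1 h1
    have h6 : j = o v := by
      by_contra hne
      refine h2 ⟨_, ⟨_, ⟨v, by omega, rfl⟩, rfl⟩, ?_⟩
      rw [h.mem_internalDiagonals h3 h4]
      exact ⟨rfl, j, hj1, by omega, rfl⟩
    rw [h6, h.iterate_next_apply h3 h4] at h5 ⊢
    refine ⟨v, ⟨?_, by omega⟩, rfl, rfl⟩
    rintro rfl
    exact h5 ⟨rfl, h.next_one⟩
  · rintro ⟨v, ⟨h1, h2⟩, rfl, rfl⟩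
    obtain ⟨h3, h4⟩ := h.support v h2
    refine ⟨h.mem_pathTri_iff.2 ⟨h3, h4, fun h5 => h1 h5.1, o v, by omega, le_rfl,
      (h.iterate_next_apply h3 h4).symm⟩, ?_⟩
    rintro ⟨_, ⟨_, ⟨u, hu, rfl⟩, rfl⟩, h5⟩
    obtain ⟨hu1, hu2⟩ := h.support u hu
    rw [h.mem_internalDiagonals hu1 hu2] at h5
    obtain ⟨rfl, j, hj1, hj2, h6⟩ := h5
    replace hj2 : j < o v := hj2
    rw [← h.iterate_next_apply h3 h4] at h6
    have := h.iterate_next_inj h3 h4 le_rfl hj2.le h6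
    omega

theorem contract_pathTri : contract N (pathTri N o) =
    ((peaks N o).toFinset.erase 1).image (fun v => (flats o v, flats o (next o v))) := by
  rw [contract, h.pathTri_sdiff_internalDiagonals, Finset.image_image]
  refine Finset.image_congr fun v hv => ?_
  have hv := (mem_peaks h).1 (List.mem_toFinset.1 (Finset.mem_of_mem_erase (Finset.mem_coe.1 hv)))
  obtain ⟨h1, h2⟩ := h.support v hv
  have := h.lt_next h1 h2
  simp only [Function.comp_apply, contractVertex_pathTri h h1,
    contractVertex_pathTri h (show 1 ≤ next o v by omega)]

variable (ho : ∀ v, o v ≠ 1)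
include ho

/-- If the labels of `u < v` agree, there is no zero from `u` up to `v`, so all terms there are at
least `2` and the path is strictly higher at `v` than at `u`. Hence `next o v < next o u`, and the
step just before `next o u`, being a zero, separates the two labels. -/
theorem flats_lt_or {u v : ℕ} (hu : o u ≠ 0) (hv : o v ≠ 0) (huv : u < v) :
    flats o u < flats o v ∨
      (flats o u = flats o v ∧ flats o (next o v) < flats o (next o u)) := by
  obtain ⟨hu1, hu2⟩ := h.support u hu
  obtain ⟨hv1, hv2⟩ := h.support v hv
  rcases (flats_le (o := o) hu1 huv.le).lt_or_eq with h1 | h1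
  · exact Or.inl h1
  refine Or.inr ⟨h1, ?_⟩
  have h2 : ∀ x ∈ Finset.Ico u v, 2 ≤ o x := by
    intro x hx
    rw [Finset.mem_Ico] at hx
    have h3 : o x ≠ 0 := fun h0 => (flats_lt hu1 hx.1 hx.2 h0).ne h1
    have := ho x
    omega
  have h3 := h.lt_next hu1 hu2
  have h4 := h.apply_next_sub_one hu1 hu2
  have h5 : v < next o u := by
    by_contra hc
    have := h2 (next o u - 1) (by rw [Finset.mem_Ico]; omega)
    omega
  have h6 : _ ≤ ∑ x ∈ Finset.Ico u v, o x := Finset.card_nsmul_le_sum _ _ _ h2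
  rw [Nat.card_Ico, smul_eq_mul] at h6
  have h7 := height_sub o hu1 huv.le
  have h8 := h.height_next hu1 hu2
  have h9 := h.height_next hv1 hv2
  have h10 : next o v ≤ next o u := next_le_of_height_lt h5 (by omega)
  have h11 : next o v ≠ next o u := by
    intro h11
    rw [h11] at h9
    omega
  have h12 := h.lt_next hv1 hv2
  exact flats_lt (x := next o u - 1) (by omega) (by omega) (by omega) h4

theorem flats_lex_iff {u v : ℕ} (hu : o u ≠ 0) (hv : o v ≠ 0) :
    (flats o u < flats o v ∨
      (flats o u = flats o v ∧ flats o (next o v) < flats o (next o u))) ↔ u < v := by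
  refine ⟨fun h1 => ?_, h.flats_lt_or ho hu hv⟩
  by_contra hc
  rcases (not_lt.mp hc).eq_or_lt with rfl | h2
  · omega
  · have := h.flats_lt_or ho hv hu h2
    omega

theorem flats_injOn : Set.InjOn (fun v => (flats o v, flats o (next o v))) {v | o v ≠ 0} := by
  intro u hu v hv huv
  rw [Prod.mk.injEq] at huv
  by_contra hne
  rcases lt_or_gt_of_ne hne with h1 | h1
  · have := h.flats_lt_or ho hu hv h1; omega
  · have := h.flats_lt_or ho hv hu h1; omega

-- The step just before `next o v` is a zero, so no position before `next o v` shares its label.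
omit ho in
theorem flats_lt_flats_next_iff {u v : ℕ} (hu : o u ≠ 0) (hv : o v ≠ 0) :
    flats o u < flats o (next o v) ↔ u < next o v := by
  obtain ⟨hu1, hu2⟩ := h.support u hu
  obtain ⟨hv1, hv2⟩ := h.support v hv
  have h1 := h.lt_next hv1 hv2
  refine ⟨lt_of_flats_lt (by omega), fun h2 => ?_⟩
  exact flats_lt hu1 (x := next o v - 1) (by omega) (by omega) (h.apply_next_sub_one hv1 hv2)

-- The peak `1` belongs to the region at the side `(1, N)`, which has no chord of its own; it
-- accounts for the `+ 1` in `expandChord`.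
omit ho in
theorem filter_peaks_erase (hN : 3 ≤ N) {w : ℕ} (hw : 1 < w) :
    (((peaks N o).toFinset.erase 1).filter (· < w)).card + 1 =
      ((peaks N o).toFinset.filter (· < w)).card := by
  rw [Finset.filter_erase, Finset.card_erase_add_one]
  simp [mem_peaks h, h.apply_one hN, hw]

theorem contract_mem_Dis (hN : 3 ≤ N) : contract N (pathTri N o) ∈
    Dis (N - (peaks N o).length) ((peaks N o).length - 1) := by
  have hlen : (peaks N o).toFinset.card = (peaks N o).length :=
    List.toFinset_card_of_nodup (sortedLT_peaks N o).nodup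
  have hflN := flats_add_card h (v := N) (by omega)
  rw [Finset.filter_true_of_mem (fun v hv =>
    (h.support v ((mem_peaks h).1 (List.mem_toFinset.1 hv))).2), hlen] at hflN
  rw [h.contract_pathTri]
  refine ⟨?_, ?_, ?_⟩
  · simp only [Finset.forall_mem_image, Finset.mem_erase, List.mem_toFinset, mem_peaks h]
    rintro v ⟨hv1, hv⟩
    obtain ⟨h1, h2⟩ := h.support v hv
    have h3 := h.lt_next h1 h2
    have h4 := h.next_le h1 h2
    have h5 := flats_le (o := o) (by omega) h4
    refine ⟨?_, ?_, ?_, ?_⟩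
    · simp only [flats]; omega
    · have h6 := flats_add o h1 h3.le
      have h7 := height_sub o h1 h3.le
      rw [h.height_next h1 h2] at h7
      have h8 : next o v ≠ v + 1 := (h.next_eq_succ_iff h1 h2).not.2 hv
      -- Terms are `0` or at least `2`, and over a stretch of length `L ≥ 2` they add up to `L - 1`.
      -- So at least `(L + 1) / 2 > 1` of them are zero, and the contracted chord is not a side.
      have h9 : ∑ x ∈ Finset.Ico v (next o v), 2 ≤
          ∑ x ∈ Finset.Ico v (next o v), (o x + 2 * if o x = 0 then 1 else 0) :=
        Finset.sum_le_sum fun x _ => by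
          have := ho x
          split_ifs <;> omega
      rw [Finset.sum_add_distrib, ← Finset.mul_sum, ← Finset.card_filter, Finset.sum_const,
        Nat.card_Ico, smul_eq_mul] at h9
      simp only
      omega
    · simp only; omega
    · rintro ⟨h6, h7⟩
      -- The labels `(1, last)` are already those of the arc at the peak `1`.
      have h8 := h.flats_lt_or ho (h.apply_one hN) hv (by omega)
      rw [flats_one, h.next_one] at h8
      simp only at h6 h7
      omega
  · simp only [Finset.forall_mem_image, Finset.mem_erase, List.mem_toFinset, mem_peaks h]
    rintro u ⟨-, hu⟩ v ⟨-, hv⟩ ⟨h1, h2, h3⟩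
    obtain ⟨hu1, hu2⟩ := h.support u hu
    obtain ⟨hv1, hv2⟩ := h.support v hv
    have h4 := h.lt_next hu1 hu2
    have h5 := h.lt_next hv1 hv2
    exact (h.pathEdge_next hu1 hu2).not_crosses (c := (u, next o u)) (d := (v, next o v))
      (h.pathEdge_next hv1 hv2) ⟨lt_of_flats_lt hv1 h1, lt_of_flats_lt (by omega) h2,
        lt_of_flats_lt (by omega) h3⟩
  · rw [Finset.card_image_of_injOn, Finset.card_erase_of_mem, hlen]
    · simpa [mem_peaks h] using h.apply_one hN
    · refine (h.flats_injOn ho).mono fun v hv => ?_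
      simp only [Finset.coe_erase, List.coe_toFinset, Set.mem_sdiff, Set.mem_ofPred_eq,
        mem_peaks h] at hv
      exact hv.1

theorem expandChord_contract (hN : 3 ≤ N) {v : ℕ} (hv1 : v ≠ 1) (hv : o v ≠ 0) :
    expandChord (contract N (pathTri N o)) (flats o v, flats o (next o v)) = (v, next o v) := by
  obtain ⟨h1, h2⟩ := h.support v hv
  have h3 := h.lt_next h1 h2
  -- A position equals its label plus the number of peaks before it. The peak `1` gives the `+ 1`,
  -- and the others are counted by any condition `p` on labels that detects `u < w`.
  have key : ∀ (p : ℕ × ℕ → Prop) [DecidablePred p] (w : ℕ), 1 < w →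
      (∀ u, o u ≠ 0 → (p (flats o u, flats o (next o u)) ↔ u < w)) →
      flats o w + 1 + ((contract N (pathTri N o)).filter p).card = w := by
    intro p _ w hw hp
    rw [h.contract_pathTri, Finset.filter_image, Finset.card_image_of_injOn]
    · rw [Finset.filter_congr (q := (· < w)) fun u hu => hp u ?_]
      · have := h.filter_peaks_erase hN hw
        have := flats_add_card h (v := w) (by omega)
        omega
      · simpa [mem_peaks h] using Finset.mem_of_mem_erase hu
    · refine (h.flats_injOn ho).mono fun v hv => ?_
      simp only [Finset.coe_filter, Finset.mem_erase, List.mem_toFinset, Set.mem_ofPred_eq,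
        mem_peaks h] at hv
      exact hv.1.2
  rw [expandChord, Prod.mk.injEq]
  exact ⟨key _ v (by omega) fun u hu => h.flats_lex_iff ho hu hv,
    key _ (next o v) (by omega) fun u hu => h.flats_lt_flats_next_iff hu hv⟩

-- A vertex of the region below `(v, next o v)` is one that no other surviving arc nested in it
-- passes over; these are exactly the neighbours of `v`.
omit ho in
theorem mem_regionDiagonals {v : ℕ} (hv : o v ≠ 0) {c : ℕ × ℕ} :
    c ∈ regionDiagonals (((peaks N o).toFinset.erase 1).image (fun v => (v, next o v)))
      (v, next o v) ↔ c.1 = v ∧ v + 1 < c.2 ∧ c.2 < next o v ∧ PathEdge o v c.2 := by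
  obtain ⟨a, w⟩ := c
  obtain ⟨h1, h2⟩ := h.support v hv
  have hnv := h.next_le h1 h2
  simp only [regionDiagonals, Finset.mem_image, Finset.mem_filter, Finset.mem_Ioo,
    Finset.mem_erase, List.mem_toFinset, mem_peaks h, Prod.mk.injEq]
  constructor
  · rintro ⟨w, ⟨⟨h3, h4⟩, h5⟩, rfl, rfl⟩
    have h6 := height_le_of_lt_next (by omega) h4
    refine ⟨rfl, h3, h4, by omega, ?_, by omega⟩
    by_contra! hc
    obtain ⟨x, hx1, hx2, hx3⟩ := hc
    -- If `w` is not a neighbour of `v`, a lowest position `u` strictly between them is no higher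
    -- than `w`, so the arc from `u` to `next o u` passes over `w`.
    obtain ⟨u, hu, humin⟩ := Finset.exists_min_image (Finset.Ioo v w) (height o)
      ⟨x, Finset.mem_Ioo.2 ⟨hx1, hx2⟩⟩
    have hux := humin x (Finset.mem_Ioo.2 ⟨hx1, hx2⟩)
    rw [Finset.mem_Ioo] at hu
    have hnu := h.next_mem (v := u) (by omega) (by omega)
    have h7 : w < next o u := by
      by_contra hc
      rcases (not_lt.mp hc).eq_or_lt with h8 | h8
      · rw [h8] at hnu; omega
      · have := humin _ (Finset.mem_Ioo.2 ⟨by omega, h8⟩); omega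
    have hou : o u ≠ 0 := by
      rw [Ne, ← h.next_eq_succ_iff (by omega) (by omega)]
      omega
    have h8 := height_le_of_lt_next (o := o) (v := v) (u := u) (by omega) (by omega)
    have h9 := h.height_next h1 h2
    refine h5 (u, next o u) ⟨u, ⟨by omega, hou⟩, rfl⟩ ?_ (by simp only; omega)
      (next_le_of_height_lt (by omega) (by omega)) ⟨hu.2, h7⟩
    rw [Ne, Prod.mk.injEq]
    omega
  · rintro ⟨rfl, h3, h4, h5⟩
    refine ⟨w, ⟨⟨h3, h4⟩, ?_⟩, rfl, rfl⟩
    rintro _ ⟨u, ⟨-, hu⟩, rfl⟩ h6 h7 - ⟨h8, h9⟩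
    simp only at h6 h7 h8 h9
    have h10 : u ≠ a := by rintro rfl; exact h6 rfl
    have := h5.2.1 u (by omega) h8
    have := height_le_of_lt_next h8.le h9
    omega

theorem expand_contract (hN : 3 ≤ N) : expand N (contract N (pathTri N o)) = pathTri N o := by
  have hE : (contract N (pathTri N o)).image (expandChord (contract N (pathTri N o))) =
      ((peaks N o).toFinset.erase 1).image (fun v => (v, next o v)) := by
    conv_lhs => enter [2]; rw [h.contract_pathTri]
    rw [Finset.image_image]
    refine Finset.image_congr fun v hv => ?_
    simp only [Finset.coe_erase, List.coe_toFinset, Set.mem_sdiff, Set.mem_ofPred_eq,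
      mem_peaks h, Set.mem_singleton_iff] at hv
    exact h.expandChord_contract ho hN hv.2 hv.1
  have hE' : insert (1, N) (((peaks N o).toFinset.erase 1).image (fun v => (v, next o v))) =
      (peaks N o).toFinset.image (fun v => (v, next o v)) := by
    conv_rhs => rw [← Finset.insert_erase (a := 1) (s := (peaks N o).toFinset)
      (by simpa [mem_peaks h] using h.apply_one hN), Finset.image_insert, h.next_one]
  rw [expand, hE, hE']
  ext ⟨v, w⟩
  rw [Finset.mem_union, Finset.mem_biUnion, Finset.exists_mem_image, h.mem_pathTri_iff]
  simp only [Finset.mem_image, Finset.mem_erase, List.mem_toFinset,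
    mem_peaks h, Prod.mk.injEq]
  constructor
  · rintro (⟨v, ⟨h1, h2⟩, rfl, rfl⟩ | ⟨u, hu, h1⟩)
    · obtain ⟨h3, h4⟩ := h.support v h2
      exact ⟨h3, h4, by omega, o v, by omega, le_rfl, (h.iterate_next_apply h3 h4).symm⟩
    · rw [h.mem_regionDiagonals hu] at h1
      obtain ⟨rfl, h2, h3, h4⟩ := h1
      simp only at hu h2 h3 h4 ⊢
      obtain ⟨h5, h6⟩ := h.support _ hu
      have h7 := h.next_le h5 h6
      obtain ⟨j, hj, rfl⟩ := (h.pathEdge_iff h5 h6).1 ⟨h4, by omega⟩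
      refine ⟨h5, h6, by omega, j, ?_, hj, rfl⟩
      rcases j with _ | j
      · simp at h2
      · omega
  · rintro ⟨h1, h2, h3, j, hj1, hj2, rfl⟩
    have h0 : o v ≠ 0 := by omega
    rcases hj2.eq_or_lt with rfl | hj
    · rw [h.iterate_next_apply h1 h2] at h3 ⊢
      refine Or.inl ⟨v, ⟨?_, h0⟩, rfl, rfl⟩
      rintro rfl
      exact h3 ⟨rfl, h.next_one⟩
    · refine Or.inr ⟨v, h0, ?_⟩
      rw [h.mem_regionDiagonals h0]
      have h4 := h.iterate_next_strictMono h1 h2 (j := 0) hj1 hj2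
      have h5 := h.iterate_next_strictMono h1 h2 hj le_rfl
      rw [h.iterate_next_apply h1 h2] at h5
      exact ⟨rfl, by simpa using h4, h5, (h.iterate_next h1 h2 j hj2).1⟩

end IsLukasiewicz

/-! ### Every dissection is a contraction -/

/-- The left end of the innermost arc of `A` above `m`. -/
def owner (A : Finset (ℕ × ℕ)) (m : ℕ) : ℕ :=
  (A.filter (fun e => e.1 < m ∧ m < e.2)).sup Prod.fst

/-- The number of vertices whose innermost arc starts at `v`. -/
def ownSteps (N : ℕ) (A : Finset (ℕ × ℕ)) (v : ℕ) : ℕ :=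
  ((Finset.Ioo 1 N).filter (fun m => owner A m = v)).card

/-- A non-crossing set of arcs with distinct left ends, containing the arc `(1, N)`. -/
structure ArcSystem (N : ℕ) (A : Finset (ℕ × ℕ)) : Prop where
  root : (1, N) ∈ A
  range : ∀ e ∈ A, 1 ≤ e.1 ∧ e.1 + 1 < e.2 ∧ e.2 ≤ N
  not_crosses : ∀ c ∈ A, ∀ d ∈ A, ¬ Crosses c d
  left_inj : ∀ c ∈ A, ∀ d ∈ A, c.1 = d.1 → c = d

namespace ArcSystem

variable {N : ℕ} {A : Finset (ℕ × ℕ)} (hA : ArcSystem N A)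
include hA

omit hA in
theorem le_owner {e : ℕ × ℕ} (he : e ∈ A) {m : ℕ} (h1 : e.1 < m) (h2 : m < e.2) :
    e.1 ≤ owner A m :=
  Finset.le_sup (f := Prod.fst) (Finset.mem_filter.2 ⟨he, h1, h2⟩)

theorem exists_owner {m : ℕ} (h1 : 1 < m) (h2 : m < N) :
    ∃ e ∈ A, owner A m = e.1 ∧ e.1 < m ∧ m < e.2 := by
  obtain ⟨e, he, he'⟩ := Finset.exists_mem_eq_sup (A.filter (fun e => e.1 < m ∧ m < e.2))
    ⟨(1, N), Finset.mem_filter.2 ⟨hA.root, h1, h2⟩⟩ Prod.fst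
  rw [Finset.mem_filter] at he
  exact ⟨e, he.1, he', he.2⟩

omit hA in
theorem sum_ownSteps (v w : ℕ) : ∑ u ∈ Finset.Ico v w, ownSteps N A u =
    ((Finset.Ioo 1 N).filter (fun m => v ≤ owner A m ∧ owner A m < w)).card := by
  rw [Finset.card_eq_sum_card_fiberwise (f := owner A) (t := Finset.Ico v w)]
  · refine Finset.sum_congr rfl fun u hu => ?_
    rw [Finset.mem_Ico] at hu
    rw [Finset.filter_filter, ownSteps]
    congr 1
    refine Finset.filter_congr fun m _ => ?_
    omega
  · intro m hm
    simp only [Finset.coe_filter, Set.mem_ofPred_eq] at hm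
    simpa using hm.2

/-- The vertices whose owner lies in `[e.1, e.2)` are exactly those strictly below `e`. Distinct
left ends are needed when the owner is `e.1` itself. -/
theorem height_right {e : ℕ × ℕ} (he : e ∈ A) :
    height (ownSteps N A) e.2 = height (ownSteps N A) e.1 - 1 := by
  obtain ⟨h1, h2, h3⟩ := hA.range e he
  have h4 := height_sub (ownSteps N A) h1 (show e.1 ≤ e.2 by omega)
  have h5 : (Finset.Ioo 1 N).filter (fun m => e.1 ≤ owner A m ∧ owner A m < e.2) =
      Finset.Ioo e.1 e.2 := by
    ext m
    rw [Finset.mem_filter, Finset.mem_Ioo, Finset.mem_Ioo]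
    constructor
    · rintro ⟨⟨h5, h6⟩, h7, h8⟩
      obtain ⟨c, hc, hce, h9, h10⟩ := hA.exists_owner h5 h6
      rw [hce] at h7 h8
      refine ⟨by omega, ?_⟩
      rcases h7.eq_or_lt with h11 | h11
      · rwa [hA.left_inj e he c hc h11]
      · have := hA.not_crosses e he c hc
        simp only [Crosses] at this
        omega
    · rintro ⟨h5, h6⟩
      obtain ⟨c, hc, hce, h9, h10⟩ := hA.exists_owner (m := m) (by omega) (by omega)
      have := le_owner he h5 h6
      omega
  rw [sum_ownSteps, h5, Nat.card_Ioo] at h4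
  omega

/-- Every vertex `m` with `e.1 < m ≤ w` has its owner in `[e.1, w)`, which supplies at least `w -
e.1` steps. -/
theorem height_le {e : ℕ × ℕ} (he : e ∈ A) {w : ℕ} (hw1 : e.1 ≤ w) (hw2 : w < e.2) :
    height (ownSteps N A) e.1 ≤ height (ownSteps N A) w := by
  obtain ⟨h1, h2, h3⟩ := hA.range e he
  have h4 := height_sub (ownSteps N A) h1 hw1
  have h5 : Finset.Ioc e.1 w ⊆
      (Finset.Ioo 1 N).filter (fun m => e.1 ≤ owner A m ∧ owner A m < w) := by
    intro m hm
    rw [Finset.mem_Ioc] at hm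
    obtain ⟨c, hc, hce, h9, h10⟩ := hA.exists_owner (m := m) (by omega) (by omega)
    have := le_owner he hm.1 (by omega)
    rw [Finset.mem_filter, Finset.mem_Ioo]
    omega
  have h6 := Finset.card_le_card h5
  rw [Nat.card_Ioc] at h6
  rw [sum_ownSteps] at h4
  omega

theorem isLukasiewicz : IsLukasiewicz N (ownSteps N A) := by
  have hlast := hA.height_right hA.root
  simp only [height_one] at hlast
  refine ⟨fun u hu => ?_, fun v h1 h2 => ?_, by omega⟩
  · rw [ownSteps, Finset.card_ne_zero] at hu
    obtain ⟨m, hm⟩ := hu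
    rw [Finset.mem_filter, Finset.mem_Ioo] at hm
    obtain ⟨c, hc, hce, h3, h4⟩ := hA.exists_owner hm.1.1 hm.1.2
    have := hA.range c hc
    omega
  · rw [← height_one (ownSteps N A)]
    exact hA.height_le hA.root h1 h2

theorem next_eq {e : ℕ × ℕ} (he : e ∈ A) : next (ownSteps N A) e.1 = e.2 := by
  obtain ⟨h1, h2, h3⟩ := hA.range e he
  have h4 := hA.height_right he
  exact hA.isLukasiewicz.next_eq h1 (by omega) (by omega) (by omega)
    fun u hu1 hu2 => hA.height_le he hu1.le hu2

theorem ownSteps_ne_zero_iff {v : ℕ} : ownSteps N A v ≠ 0 ↔ ∃ e ∈ A, e.1 = v := by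
  constructor
  · intro hu
    rw [ownSteps, Finset.card_ne_zero] at hu
    obtain ⟨m, hm⟩ := hu
    rw [Finset.mem_filter, Finset.mem_Ioo] at hm
    obtain ⟨c, hc, hce, -⟩ := hA.exists_owner hm.1.1 hm.1.2
    exact ⟨c, hc, by omega⟩
  · rintro ⟨e, he, rfl⟩
    obtain ⟨h1, h2, h3⟩ := hA.range e he
    have h4 := hA.next_eq he
    rw [Ne, ← hA.isLukasiewicz.next_eq_succ_iff h1 (by omega)]
    omega

/-- After a term `1` at `e.1` the path stays level, so it first drops from `e.1 + 1` at `e.2` too.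
As `e.2` is not adjacent to `e.1 + 1`, this would make `(e.1 + 1, e.2)` an arc. -/
theorem ownSteps_ne_one (hred : ∀ e ∈ A, e.1 + 2 < e.2 ∧ (e.1 + 1, e.2) ∉ A) (v : ℕ) :
    ownSteps N A v ≠ 1 := by
  intro hv
  have hL := hA.isLukasiewicz
  obtain ⟨e, he, rfl⟩ := hA.ownSteps_ne_zero_iff.1 (by omega : ownSteps N A v ≠ 0)
  obtain ⟨h1, h2, h3⟩ := hA.range e he
  obtain ⟨h4, h5⟩ := hred e he
  have h6 := height_succ (ownSteps N A) h1
  have h7 := hA.height_right he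
  have h8 : next (ownSteps N A) (e.1 + 1) = e.2 := by
    refine hL.next_eq (by omega) (by omega) h2 (by omega) fun u hu1 hu2 => ?_
    have := hA.height_le he (w := u) (by omega) hu2
    omega
  obtain ⟨d, hd, hd1⟩ := hA.ownSteps_ne_zero_iff.1
    ((hL.next_eq_succ_iff (v := e.1 + 1) (by omega) (by omega)).not.1 (by omega))
  have h9 := hA.next_eq hd
  rw [hd1, h8] at h9
  exact h5 (by rwa [← hd1, h9])

end ArcSystem

/-! ### Adding one side for every arc -/

section Lift

/-- The order in which the sides for the arcs are added. -/
def Precedes (d c : ℕ × ℕ) : Prop := d.1 < c.1 ∨ (d.1 = c.1 ∧ c.2 < d.2)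

instance (d c : ℕ × ℕ) : Decidable (Precedes d c) := by unfold Precedes; infer_instance

theorem Precedes.trichotomy (c d : ℕ × ℕ) : c = d ∨ Precedes c d ∨ Precedes d c := by
  simp only [Precedes, Prod.ext_iff]; omega

/-- The left end of the arc `c` after one side has been added for each arc of `A`. -/
def liftLeft (A : Finset (ℕ × ℕ)) (c : ℕ × ℕ) : ℕ := c.1 + (A.filter (Precedes · c)).card

/-- The right end of an arc ending at `q` after one side has been added for each arc of `A`. -/
def liftRight (A : Finset (ℕ × ℕ)) (q : ℕ) : ℕ := q + (A.filter (·.1 < q)).card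

variable {A : Finset (ℕ × ℕ)}

theorem card_filter_precedes_lt {c d : ℕ × ℕ} (hd : d ∈ A) (h : Precedes d c) :
    (A.filter (Precedes · d)).card < (A.filter (Precedes · c)).card := by
  refine Finset.card_lt_card ⟨fun x hx => ?_, fun hc => ?_⟩
  · rw [Finset.mem_filter] at hx ⊢
    refine ⟨hx.1, ?_⟩
    have := hx.2
    simp only [Precedes] at *
    omega
  · have := hc (Finset.mem_filter.2 ⟨hd, h⟩)
    exact absurd (Finset.mem_filter.1 this).2 (by simp [Precedes])

theorem liftLeft_lt {c d : ℕ × ℕ} (hd : d ∈ A) (h : Precedes d c) :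
    liftLeft A d < liftLeft A c := by
  have h1 := card_filter_precedes_lt hd h
  have h2 : d.1 ≤ c.1 := by simp only [Precedes] at h; omega
  simp only [liftLeft]
  omega

theorem liftLeft_lt_iff {c d : ℕ × ℕ} (hc : c ∈ A) (hd : d ∈ A) :
    liftLeft A d < liftLeft A c ↔ Precedes d c := by
  refine ⟨fun h => ?_, liftLeft_lt hd⟩
  rcases Precedes.trichotomy c d with rfl | h1 | h1
  · omega
  · have := liftLeft_lt hc h1; omega
  · exact h1

theorem liftLeft_inj {c d : ℕ × ℕ} (hc : c ∈ A) (hd : d ∈ A) (h : liftLeft A c = liftLeft A d) :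
    c = d := by
  rcases Precedes.trichotomy c d with h1 | h1 | h1
  · exact h1
  · have := liftLeft_lt hc h1; omega
  · have := liftLeft_lt hd h1; omega

theorem card_filter_precedes_lt_card {d : ℕ × ℕ} (hd : d ∈ A) {q : ℕ} (h : d.1 < q) :
    (A.filter (Precedes · d)).card < (A.filter (·.1 < q)).card := by
  refine Finset.card_lt_card ⟨fun x hx => ?_, fun hc => ?_⟩
  · rw [Finset.mem_filter] at hx ⊢
    refine ⟨hx.1, ?_⟩
    have := hx.2
    simp only [Precedes] at this
    omega
  · have := hc (Finset.mem_filter.2 ⟨hd, h⟩)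
    exact absurd (Finset.mem_filter.1 this).2 (by simp [Precedes])

theorem liftLeft_lt_liftRight_iff {d : ℕ × ℕ} (hd : d ∈ A) {q : ℕ} :
    liftLeft A d < liftRight A q ↔ d.1 < q := by
  constructor
  · intro h
    by_contra hc
    have h1 : (A.filter (·.1 < q)).card ≤ (A.filter (Precedes · d)).card := by
      refine Finset.card_le_card fun x hx => ?_
      rw [Finset.mem_filter] at hx ⊢
      exact ⟨hx.1, Or.inl (by omega)⟩
    simp only [liftLeft, liftRight] at h
    omega
  · intro h
    have := card_filter_precedes_lt_card hd h
    simp only [liftLeft, liftRight]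
    omega

theorem liftRight_strictMono : StrictMono (liftRight A) := by
  intro q q' h
  have : (A.filter (·.1 < q)).card ≤ (A.filter (·.1 < q')).card := by
    refine Finset.card_le_card fun x hx => ?_
    rw [Finset.mem_filter] at hx ⊢
    exact ⟨hx.1, by omega⟩
  simp only [liftRight]
  omega

theorem liftRight_le (q : ℕ) : liftRight A q ≤ q + A.card :=
  Nat.add_le_add_left (Finset.card_filter_le _ _) _

end Lift

/-! ### The lifted arcs of a dissection -/

section LiftArcs

variable {M i : ℕ} {D : Finset (ℕ × ℕ)}

/-- The arcs of a dissection of the `M`-gon, lifted to the polygon with one more side for each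
region. -/
def liftArcs (M : ℕ) (D : Finset (ℕ × ℕ)) : Finset (ℕ × ℕ) :=
  (insert (1, M) D).image
    (fun c => (liftLeft (insert (1, M) D) c, liftRight (insert (1, M) D) c.2))

theorem lift_root (hM : 3 ≤ M) (hD : D ∈ Dis M i) :
    liftLeft (insert (1, M) D) (1, M) = 1 ∧ liftRight (insert (1, M) D) M = M + i + 1 := by
  obtain ⟨h1, h2, h3⟩ := Dis.arcs hM hD
  constructor
  · rw [liftLeft, Finset.filter_false_of_mem, Finset.card_empty]
    intro d hd
    have := h1 d hd
    simp only [Precedes]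
    omega
  · rw [liftRight, Finset.filter_true_of_mem, h3, add_assoc]
    intro d hd
    have := h1 d hd
    omega

/-- The side added for `c` itself shifts its right end but not its left end. -/
theorem liftLeft_add_two_lt (hM : 3 ≤ M) (hD : D ∈ Dis M i) {c : ℕ × ℕ}
    (hc : c ∈ insert (1, M) D) :
    liftLeft (insert (1, M) D) c + 2 < liftRight (insert (1, M) D) c.2 := by
  have h1 := (Dis.arcs hM hD).1 c hc
  have := card_filter_precedes_lt_card hc (q := c.2) (by omega)
  simp only [liftLeft, liftRight]
  omega

theorem arcSystem_liftArcs (hM : 3 ≤ M) (hD : D ∈ Dis M i) :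
    ArcSystem (M + i + 1) (liftArcs M D) := by
  obtain ⟨h1, h2, h3⟩ := Dis.arcs hM hD
  refine ⟨?_, ?_, ?_, ?_⟩
  · rw [liftArcs, Finset.mem_image]
    obtain ⟨h4, h5⟩ := lift_root hM hD
    exact ⟨(1, M), Finset.mem_insert_self _ _, by rw [h4, h5]⟩
  · simp only [liftArcs, Finset.forall_mem_image]
    intro c hc
    have h4 := liftLeft_add_two_lt hM hD hc
    have h5 := h1 c hc
    have h6 := liftRight_le (A := insert (1, M) D) c.2
    refine ⟨?_, by omega, by omega⟩
    simp only [liftLeft]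
    omega
  · simp only [liftArcs, Finset.forall_mem_image, Crosses]
    rintro c hc d hd ⟨h4, h5, h6⟩
    rw [liftLeft_lt_iff hd hc] at h4
    rw [liftLeft_lt_liftRight_iff hd] at h5
    rw [liftRight_strictMono.lt_iff_lt] at h6
    have := h2 c hc d hd
    simp only [Crosses, Precedes] at *
    omega
  · simp only [liftArcs, Finset.forall_mem_image]
    intro c hc d hd hcd
    rw [liftLeft_inj hc hd hcd]

/-- If the lift of `d` ended with that of `c` and started one later, then `d.2 = c.2`, and so `c.1 <
d.1`. But the side added for `c` lies between the two left ends as well, making them differ by at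
least two. -/
theorem liftArcs_reduced (hM : 3 ≤ M) (hD : D ∈ Dis M i) :
    ∀ e ∈ liftArcs M D, e.1 + 2 < e.2 ∧ (e.1 + 1, e.2) ∉ liftArcs M D := by
  simp only [liftArcs, Finset.forall_mem_image]
  intro c hc
  refine ⟨liftLeft_add_two_lt hM hD hc, fun hd => ?_⟩
  obtain ⟨d, hd, hdc⟩ := Finset.mem_image.1 hd
  rw [Prod.mk.injEq] at hdc
  have h1 := liftRight_strictMono.injective hdc.2
  have h2 := (liftLeft_lt_iff hd hc).1 (by omega)
  have h3 := card_filter_precedes_lt hc h2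
  have h4 := hdc.1
  simp only [liftLeft] at h4
  simp only [Precedes] at h2
  omega

/-- The peaks are the lifted left ends, so the number of peaks before a lifted end is the amount by
which it was shifted, and contraction subtracts precisely that. -/
theorem exists_contract_eq (hM : 3 ≤ M) (hD : D ∈ Dis M i) :
    ∃ o ∈ LukSeq (M + i + 1) (i + 1), contract (M + i + 1) (pathTri (M + i + 1) o) = D := by
  have hA := arcSystem_liftArcs hM hD
  have hL := hA.isLukasiewicz
  obtain ⟨hrange, -, hcard⟩ := Dis.arcs hM hD
  set N := M + i + 1
  set A := insert (1, M) D with hAdef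
  set o := ownSteps N (liftArcs M D)
  have hinj : Set.InjOn (liftLeft A) A := fun c hc d hd => liftLeft_inj hc hd
  have hpeaks : (peaks N o).toFinset = A.image (liftLeft A) := by
    ext v
    rw [List.mem_toFinset, mem_peaks hL, hA.ownSteps_ne_zero_iff]
    rw [liftArcs, Finset.exists_mem_image, Finset.mem_image]
  have hflats : ∀ (p : ℕ × ℕ → Prop) [DecidablePred p] (q w : ℕ), 1 ≤ w →
      q + (A.filter p).card = w → (∀ d ∈ A, liftLeft A d < w ↔ p d) → flats o w = q := by
    intro p _ q w hw hq hp
    have h1 := flats_add_card hL hw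
    rw [hpeaks, Finset.filter_image, Finset.card_image_of_injOn
      (hinj.mono (Finset.coe_subset.2 (Finset.filter_subset _ _))), Finset.filter_congr hp] at h1
    omega
  refine ⟨o, ⟨hL, hA.ownSteps_ne_one (liftArcs_reduced hM hD), ?_⟩, ?_⟩
  · rw [← List.toFinset_card_of_nodup (sortedLT_peaks N o).nodup, hpeaks,
      Finset.card_image_of_injOn hinj, hcard]
  · have hroot := (lift_root hM hD).1
    have hnot : (1, M) ∉ D := fun h => (hD.1 _ h).2.2.2 ⟨rfl, rfl⟩
    have herase : (peaks N o).toFinset.erase 1 = D.image (liftLeft A) := by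
      rw [hpeaks, hAdef, Finset.image_insert, hroot, Finset.erase_insert]
      intro h1
      obtain ⟨d, hd, hd1⟩ := Finset.mem_image.1 h1
      have := liftLeft_inj (Finset.mem_insert_of_mem hd) (Finset.mem_insert_self _ _)
        (hd1.trans hroot.symm)
      exact hnot (this ▸ hd)
    rw [hL.contract_pathTri, herase, Finset.image_image]
    conv_rhs => rw [← Finset.image_id (s := D)]
    refine Finset.image_congr fun c hc => ?_
    have hcA : c ∈ A := Finset.mem_insert_of_mem hc
    have h1 : next o (liftLeft A c) = liftRight A c.2 :=
      hA.next_eq (e := (liftLeft A c, liftRight A c.2)) (Finset.mem_image.2 ⟨c, hcA, rfl⟩)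
    have h2 := hrange c hcA
    simp only [Function.comp_apply, id, h1]
    refine Prod.ext ?_ ?_
    · exact hflats (Precedes · c) _ _ (by simp only [liftLeft]; omega) rfl
        fun d hd => liftLeft_lt_iff hcA hd
    · exact hflats (·.1 < c.2) _ _ (by simp only [liftRight]; omega) rfl
        fun d hd => liftLeft_lt_liftRight_iff hd

end LiftArcs

theorem bijOn_contract {n i : ℕ} (hn : 1 ≤ n) :
    Set.BijOn (contract (n + i + 3)) (Tri (n + i + 3) (i + 1) 0) (Dis (n + 2) i) ∧
      ∀ T ∈ Tri (n + i + 3) (i + 1) 0, expand (n + i + 3) (contract (n + i + 3) T) = T := by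
  have hinv : ∀ T ∈ Tri (n + i + 3) (i + 1) 0,
      expand (n + i + 3) (contract (n + i + 3) T) = T := by
    intro T hT
    obtain ⟨o, ho, rfl⟩ := (bijOn_pathTri (by omega) (i + 1)).surjOn hT
    exact ho.1.expand_contract ho.2.1 (by omega)
  refine ⟨⟨fun T hT => ?_, Set.LeftInvOn.injOn hinv, fun D hD => ?_⟩, hinv⟩
  · obtain ⟨o, ho, rfl⟩ := (bijOn_pathTri (by omega) (i + 1)).surjOn hT
    have h1 := ho.1.contract_mem_Dis ho.2.1 (by omega)
    rw [ho.2.2] at h1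
    convert h1 using 2 <;> omega
  · obtain ⟨o, ho, h1⟩ := exists_contract_eq (by omega) hD
    have hN : n + 2 + i + 1 = n + i + 3 := by omega
    rw [hN] at ho h1
    exact ⟨_, (bijOn_pathTri (by omega) (i + 1)).mapsTo ho, h1⟩

/-! ### Sequences with prescribed peaks -/

/-- The sequence with value `α j` at `x j` for `j ≤ i`, and `0` elsewhere. -/
def stepsOf (i : ℕ) (x α : ℕ → ℕ) (u : ℕ) : ℕ :=
  ∑ j ∈ Finset.range (i + 1), if x j = u then α j else 0

/-- The number of positive integers below `v` outside `X`. -/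
def gaps (X : Finset ℕ) (v : ℕ) : ℕ := (Finset.Ico 1 v \ X).card

theorem gaps_mono (X : Finset ℕ) : Monotone (gaps X) := fun _ _ h =>
  Finset.card_le_card (Finset.sdiff_subset_sdiff (Finset.Ico_subset_Ico_right h) subset_rfl)

theorem gaps_lt {X : Finset ℕ} {v w : ℕ} (hv : 1 ≤ v) (hvX : v ∉ X) (h : v < w) :
    gaps X v < gaps X w := by
  refine Finset.card_lt_card ⟨Finset.sdiff_subset_sdiff (Finset.Ico_subset_Ico_right h.le)
    subset_rfl, fun hc => ?_⟩
  have := hc (Finset.mem_sdiff.2 ⟨Finset.mem_Ico.2 ⟨hv, h⟩, hvX⟩)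
  simp at this

theorem gaps_inj {X : Finset ℕ} {v w : ℕ} (hv : 1 ≤ v) (hvX : v ∉ X) (hw : 1 ≤ w) (hwX : w ∉ X)
    (h : gaps X v = gaps X w) : v = w := by
  rcases lt_trichotomy v w with h1 | h1 | h1
  · have := gaps_lt hv hvX h1; omega
  · exact h1
  · have := gaps_lt hw hwX h1; omega

theorem gaps_add_card {X : Finset ℕ} {v w : ℕ} (hv : 1 ≤ v) (hvw : v ≤ w) :
    gaps X v + (Finset.Ico v w \ X).card = gaps X w := by
  rw [gaps, gaps, ← Finset.Ico_union_Ico_eq_Ico hv hvw, Finset.union_sdiff_distrib,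
    Finset.card_union_of_disjoint]
  exact (Finset.Ico_disjoint_Ico_consecutive 1 v w).mono Finset.sdiff_subset Finset.sdiff_subset

/-- `gaps` grows by at most one per step, and only on passing an element outside `X`, so it takes
every intermediate value at such an element. -/
theorem exists_gaps_eq {X : Finset ℕ} {s m : ℕ} (h : s < gaps X (m + 1)) :
    ∃ y, 1 ≤ y ∧ y ≤ m ∧ y ∉ X ∧ gaps X y = s := by
  induction m with
  | zero => simp [gaps] at h
  | succ m ih =>
    by_cases h1 : s < gaps X (m + 1)
    · obtain ⟨y, h2, h3, h4⟩ := ih h1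
      exact ⟨y, h2, by omega, h4⟩
    · have h2 := gaps_add_card (X := X) (v := m + 1) (w := m + 1 + 1) (by omega) (by omega)
      rw [Nat.Ico_succ_singleton] at h2
      by_cases h3 : m + 1 ∈ X
      · rw [Finset.sdiff_eq_empty_iff_subset.2 (by simpa using h3), Finset.card_empty] at h2
        omega
      · have h4 := Finset.card_le_card (Finset.sdiff_subset (s := {m + 1}) (t := X))
        rw [Finset.card_singleton] at h4
        exact ⟨m + 1, by omega, le_rfl, h3, by omega⟩

/-! ### Path conditions in terms of peak positions and values -/

section StepsOf

variable {i : ℕ} {x α : ℕ → ℕ} (hx : ∀ j k, j < k → k ≤ i → x j < x k)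
include hx

theorem row_le {j k : ℕ} (hjk : j ≤ k) (hk : k ≤ i) : x j ≤ x k := by
  rcases hjk.eq_or_lt with rfl | h
  · exact le_rfl
  · exact (hx j k h hk).le

theorem row_lt_iff {j k : ℕ} (hj : j ≤ i) (hk : k ≤ i) : x j < x k ↔ j < k := by
  refine ⟨fun h => ?_, fun h => hx j k h hk⟩
  by_contra hc
  have := row_le hx (not_lt.mp hc) hj
  omega

theorem row_inj {j k : ℕ} (hj : j ≤ i) (hk : k ≤ i) (h : x j = x k) : j = k := by
  rcases lt_trichotomy j k with h1 | h1 | h1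
  · have := hx j k h1 hk; omega
  · exact h1
  · have := hx k j h1 hj; omega

theorem card_image_row {j : ℕ} (hj : j ≤ i + 1) : ((Finset.range j).image x).card = j := by
  rw [Finset.card_image_of_injOn, Finset.card_range]
  intro k hk l hl hkl
  rw [Finset.mem_coe, Finset.mem_range] at hk hl
  exact row_inj hx (by omega) (by omega) hkl

theorem exists_cut (v : ℕ) : ∃ j ≤ i + 1, ∀ k ≤ i, x k < v ↔ k < j := by
  have hex : ∃ j, j ≤ i → v ≤ x j := ⟨i + 1, fun h => by omega⟩
  refine ⟨Nat.find hex, Nat.find_min' hex fun h => by omega, fun k hk => ?_⟩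
  constructor
  · intro h
    by_contra hc
    have h1 := Nat.find_spec hex (by omega)
    have := row_le hx (not_lt.mp hc) hk
    omega
  · intro h
    have := Nat.find_min hex h
    by_contra hc
    exact this fun _ => by omega

theorem stepsOf_apply {j : ℕ} (hj : j ≤ i) : stepsOf i x α (x j) = α j := by
  rw [stepsOf, Finset.sum_eq_single j, if_pos rfl]
  · intro k hk hkj
    rw [Finset.mem_range] at hk
    exact if_neg fun h => hkj (row_inj hx (by omega) hj h)
  · intro h
    rw [Finset.mem_range] at h
    omega

omit hx in
theorem stepsOf_of_forall_ne {u : ℕ} (hu : ∀ j ≤ i, x j ≠ u) : stepsOf i x α u = 0 := by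
  refine Finset.sum_eq_zero fun j hj => if_neg (hu j ?_)
  rw [Finset.mem_range] at hj
  omega

theorem stepsOf_ne_zero_iff (hα : ∀ j ≤ i, α j ≠ 0) {u : ℕ} :
    stepsOf i x α u ≠ 0 ↔ ∃ j ≤ i, x j = u := by
  constructor
  · intro h
    by_contra! hc
    exact h (stepsOf_of_forall_ne hc)
  · rintro ⟨j, hj, rfl⟩
    rw [stepsOf_apply hx hj]
    exact hα j hj

theorem sum_stepsOf (hx0 : 1 ≤ x 0) {v j : ℕ} (hj : j ≤ i + 1)
    (hv : ∀ k ≤ i, x k < v ↔ k < j) :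
    ∑ u ∈ Finset.Ico 1 v, stepsOf i x α u = ∑ k ∈ Finset.range j, α k := by
  simp only [stepsOf]
  rw [Finset.sum_comm, ← Finset.sum_subset (Finset.range_subset_range.2 hj)]
  · refine Finset.sum_congr rfl fun k hk => ?_
    rw [Finset.mem_range] at hk
    have h1 := row_le hx (Nat.zero_le k) (by omega)
    have h2 := (hv k (by omega)).2 hk
    rw [Finset.sum_ite_eq, if_pos (by rw [Finset.mem_Ico]; omega)]
  · intro k hk1 hk2
    rw [Finset.mem_range] at hk1 hk2
    have := (hv k (by omega)).not.2 hk2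
    rw [Finset.sum_ite_eq, if_neg (by rw [Finset.mem_Ico]; omega)]

/-- Below `v` there are `j` entries of the row and `gaps` other positive integers. -/
theorem gaps_row (hx0 : 1 ≤ x 0) {v j : ℕ} (hj : j ≤ i + 1) (hv1 : 1 ≤ v)
    (hv : ∀ k ≤ i, x k < v ↔ k < j) :
    1 + j + gaps ((Finset.range (i + 1)).image x) v = v := by
  have h1 : Finset.Ico 1 v ∩ (Finset.range (i + 1)).image x = (Finset.range j).image x := by
    ext u
    simp only [Finset.mem_inter, Finset.mem_Ico, Finset.mem_image, Finset.mem_range]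
    constructor
    · rintro ⟨⟨h1, h2⟩, k, hk, rfl⟩
      exact ⟨k, (hv k (by omega)).1 h2, rfl⟩
    · rintro ⟨k, hk, rfl⟩
      have := row_le hx (Nat.zero_le k) (by omega)
      exact ⟨⟨by omega, (hv k (by omega)).2 hk⟩, k, by omega, rfl⟩
  have h2 := Finset.card_sdiff_add_card_inter (Finset.Ico 1 v) ((Finset.range (i + 1)).image x)
  rw [h1, card_image_row hx hj, Nat.card_Ico] at h2
  rw [gaps]
  omega

theorem peaks_stepsOf (hα : ∀ j ≤ i, α j ≠ 0) (hx0 : 1 ≤ x 0) {N : ℕ} (hN : x i < N) :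
    peaks N (stepsOf i x α) = (List.range (i + 1)).map x := by
  refine (sortedLT_peaks _ _).eq_of_mem_iff ?_ fun u => ?_
  · refine List.Pairwise.sortedLT ?_
    rw [List.pairwise_map]
    refine List.Pairwise.imp_of_mem (fun {j k} _ hk hjk => ?_) List.pairwise_lt_range
    rw [List.mem_range] at hk
    exact hx j k hjk (by omega)
  · simp only [peaks, List.mem_filter, decide_eq_true_eq, stepsOf_ne_zero_iff hx hα,
      List.mem_map, List.mem_range, List.mem_range'_1]
    constructor
    · rintro ⟨-, j, hj, rfl⟩
      exact ⟨j, by omega, rfl⟩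
    · rintro ⟨j, hj, rfl⟩
      have h1 := row_le hx (Nat.zero_le j) (by omega)
      have h2 := row_le hx (show j ≤ i by omega) le_rfl
      exact ⟨by omega, j, by omega, rfl⟩

/-- Between peaks the path only descends, so it suffices to test it on arrival at each peak and at
the end. -/
theorem isLukasiewicz_stepsOf_iff (hα : ∀ j ≤ i, α j ≠ 0) (hx0 : 1 ≤ x 0) {m : ℕ}
    (hm : x i ≤ m) : IsLukasiewicz (m + 2) (stepsOf i x α) ↔
      (∀ j ≤ i, x j ≤ 1 + ∑ k ∈ Finset.range j, α k) ∧ ∑ k ∈ Finset.range (i + 1), α k = m := by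
  have htop : ∀ v, m < v → ∑ u ∈ Finset.Ico 1 v, stepsOf i x α u =
      ∑ k ∈ Finset.range (i + 1), α k := fun v hv =>
    sum_stepsOf hx hx0 le_rfl fun k hk => by
      have := row_le hx hk le_rfl
      omega
  constructor
  · intro h
    refine ⟨fun j hj => ?_, ?_⟩
    · have h1 := row_le hx (Nat.zero_le j) hj
      have h2 := row_le hx hj le_rfl
      have h3 := h.nonneg (x j) (by omega) (by omega)
      rw [height_eq _ (by omega), sum_stepsOf hx hx0 (j := j) (by omega)
        (fun k hk => row_lt_iff hx hk hj)] at h3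
      omega
    · rw [← htop (m + 2) (by omega), h.sum_eq, Nat.add_sub_cancel]
  · rintro ⟨h1, h2⟩
    refine ⟨fun u hu => ?_, fun v hv1 hv2 => ?_, ?_⟩
    · obtain ⟨j, hj, rfl⟩ := (stepsOf_ne_zero_iff hx hα).1 hu
      have h1 := row_le hx (Nat.zero_le j) hj
      have h2 := row_le hx hj le_rfl
      omega
    · obtain ⟨j, hj, hv⟩ := exists_cut hx v
      rw [height_eq _ hv1, sum_stepsOf hx hx0 hj hv]
      rcases hj.eq_or_lt with rfl | hj
      · omega
      · have h3 := (hv j (by omega)).not.2 (lt_irrefl j)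
        have := h1 j (by omega)
        omega
    · rw [height_eq _ (by omega), htop _ (by omega)]
      omega

end StepsOf

/-! ### Tableaux of shape `[(i+1)^2, 1^(a-2)]` -/

/-- The cells of the shape `[(i+1)^2, 1^(a-2)]`. -/
def hookCells (a i : ℕ) : Finset (ℕ × ℕ) :=
  Finset.range 2 ×ˢ Finset.range (i + 1) ∪ Finset.Ico 2 a ×ˢ {0}

theorem mem_hookCells {a i r c : ℕ} :
    (r, c) ∈ hookCells a i ↔ (r < 2 ∧ c ≤ i) ∨ (2 ≤ r ∧ r < a ∧ c = 0) := by
  simp only [hookCells, Finset.mem_union, Finset.mem_product, Finset.mem_range, Finset.mem_Ico,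
    Finset.mem_singleton]
  omega

theorem card_hookCells {a : ℕ} (ha : 2 ≤ a) (i : ℕ) : (hookCells a i).card = a + 2 * i := by
  rw [hookCells, Finset.card_union_of_disjoint]
  · simp only [Finset.card_product, Finset.card_range, Nat.card_Ico, Finset.card_singleton]
    omega
  · rw [Finset.disjoint_left]
    rintro ⟨r, c⟩ h1 h2
    simp only [Finset.mem_product, Finset.mem_range, Finset.mem_Ico] at h1 h2
    omega

theorem skewCells_eq (a i : ℕ) :
    skewCells (List.replicate 2 (i + 1) ++ List.replicate (a - 2) 1)
      (List.replicate (2 - 2) (i - 1)) = hookCells a i := by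
  ext ⟨r, c⟩
  rw [Finset.mem_coe, mem_hookCells]
  rcases r with _ | _ | r
  · simp [skewCells]
  · simp [skewCells, List.replicate_succ]
  · simp only [skewCells, Set.mem_ofPred_eq, List.replicate_succ, List.replicate_zero,
      List.cons_append, List.nil_append, List.getD_cons_succ, List.getD_nil, Nat.sub_self]
    by_cases h : r < a - 2
    · simp [List.getD_eq_getElem?_getD, h]; omega
    · simp [List.getD_eq_getElem?_getD, h]; omega

theorem mem_Skyt_iff {a i : ℕ} {T : ℕ → ℕ → ℕ} : T ∈ Skyt a i 2 ↔ 2 ≤ a ∧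
    (∀ r c, (r, c) ∉ hookCells a i → T r c = 0) ∧
    Set.BijOn (fun p : ℕ × ℕ => T p.1 p.2) (hookCells a i) (Finset.Icc 1 (a + 2 * i)) ∧
    (∀ j k, j < k → k ≤ i → T 0 j < T 0 k) ∧ (∀ j k, j < k → k ≤ i → T 1 j < T 1 k) ∧
    (∀ j ≤ i, T 0 j < T 1 j) ∧ (∀ r s, r < s → s < a → T r 0 < T s 0) := by
  rw [Skyt, Set.mem_ofPred_eq, skewCells_eq, IsStandardFilling]
  simp only [le_refl, true_and, Finset.mem_coe, Set.ncard_coe_finset, Finset.coe_Icc]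
  refine and_congr_right fun ha => ?_
  rw [card_hookCells ha]
  refine and_congr_right fun _ => and_congr_right fun _ => ?_
  simp only [mem_hookCells]
  constructor
  · rintro ⟨h1, h2⟩
    exact ⟨fun j k hj hk => h1 0 j k (by omega) (by omega) hj,
      fun j k hj hk => h1 1 j k (by omega) (by omega) hj,
      fun j hj => h2 0 1 j (by omega) (by omega) one_pos,
      fun r s hr hs => h2 r s 0 (by omega) (by omega) hr⟩
  · rintro ⟨h1, h2, h3, h4⟩
    refine ⟨fun r c c' hc hc' hcc => ?_, fun r s c hr hs hrs => ?_⟩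
    · obtain rfl | rfl : r = 0 ∨ r = 1 := by omega
      · exact h1 c c' hcc (by omega)
      · exact h2 c c' hcc (by omega)
    · by_cases hs2 : s < 2
      · obtain ⟨rfl, rfl⟩ : r = 0 ∧ s = 1 := by omega
        exact h3 c (by omega)
      · obtain rfl : c = 0 := by omega
        exact h4 r s hrs (by omega)

/-- The Łukasiewicz sequence of a tableau. -/
def skytSteps (a i : ℕ) (T : ℕ → ℕ → ℕ) : ℕ → ℕ :=
  stepsOf i (T 0) (fun j => (nomBlock a i T j).card)

/-- The second row of a tableau, continued by one more than the number of entries. -/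
def secondRow (a i : ℕ) (T : ℕ → ℕ → ℕ) (j : ℕ) : ℕ := if j ≤ i then T 1 j else a + 2 * i + 1

theorem toFinset_firstRow (i : ℕ) (T : ℕ → ℕ → ℕ) :
    (firstRow i T).toFinset = (Finset.range (i + 1)).image (T 0) := by
  ext u; simp [firstRow]

/-- The entries below the first two rows. -/
def columnEntries (m i : ℕ) (x y : ℕ → ℕ) : Finset ℕ :=
  (Finset.Icc 1 m \ (Finset.range (i + 1)).image x) \ (Finset.range (i + 1)).image y

theorem card_columnEntries {a i : ℕ} {x y : ℕ → ℕ} (hx : ∀ j k, j < k → k ≤ i → x j < x k)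
    (hy : ∀ j k, j < k → k ≤ i → y j < y k) (hxm : ∀ j ≤ i, x j ∈ Finset.Icc 1 (a + 2 * i))
    (hym : ∀ j ≤ i, y j ∈ Finset.Icc 1 (a + 2 * i))
    (hyx : ∀ j ≤ i, y j ∉ (Finset.range (i + 1)).image x) :
    (columnEntries (a + 2 * i) i x y).card = a - 2 := by
  rw [columnEntries, Finset.card_sdiff_of_subset, Finset.card_sdiff_of_subset,
    card_image_row hx le_rfl, card_image_row hy le_rfl, Nat.card_Icc]
  · omega
  · intro u hu
    obtain ⟨j, hj, rfl⟩ := Finset.mem_image.1 hu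
    exact hxm j (by rw [Finset.mem_range] at hj; omega)
  · intro u hu
    obtain ⟨j, hj, rfl⟩ := Finset.mem_image.1 hu
    rw [Finset.mem_range] at hj
    exact Finset.mem_sdiff.2 ⟨hym j (by omega), hyx j (by omega)⟩

/-! ### The sequence attached to a tableau -/

section Skyt

variable {a i : ℕ} {T : ℕ → ℕ → ℕ} (hT : T ∈ Skyt a i 2)
include hT

theorem Skyt.mem_Icc {r c : ℕ} (h : (r, c) ∈ hookCells a i) :
    1 ≤ T r c ∧ T r c ≤ a + 2 * i := by
  have := (mem_Skyt_iff.1 hT).2.2.1.mapsTo (Finset.mem_coe.2 h)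
  simpa using this

theorem Skyt.exists_cell {e : ℕ} (h1 : 1 ≤ e) (h2 : e ≤ a + 2 * i) :
    ∃ r c, (r, c) ∈ hookCells a i ∧ T r c = e := by
  obtain ⟨⟨r, c⟩, h3, h4⟩ := (mem_Skyt_iff.1 hT).2.2.1.surjOn
    (show e ∈ (Finset.Icc 1 (a + 2 * i) : Set ℕ) by simpa using ⟨h1, h2⟩)
  exact ⟨r, c, h3, h4⟩

theorem Skyt.eq_of_eq {r c s d : ℕ} (h : (r, c) ∈ hookCells a i) (h' : (s, d) ∈ hookCells a i)
    (he : T r c = T s d) : r = s ∧ c = d := by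
  have := (mem_Skyt_iff.1 hT).2.2.1.injOn (Finset.mem_coe.2 h) (Finset.mem_coe.2 h') he
  simpa using this

theorem Skyt.row_zero : ∀ j k, j < k → k ≤ i → T 0 j < T 0 k := (mem_Skyt_iff.1 hT).2.2.2.1

theorem Skyt.row_one : ∀ j k, j < k → k ≤ i → T 1 j < T 1 k := (mem_Skyt_iff.1 hT).2.2.2.2.1

theorem Skyt.lt_col : ∀ j ≤ i, T 0 j < T 1 j := (mem_Skyt_iff.1 hT).2.2.2.2.2.1

theorem Skyt.col_zero : ∀ r s, r < s → s < a → T r 0 < T s 0 := (mem_Skyt_iff.1 hT).2.2.2.2.2.2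

theorem Skyt.notMem_row {r c : ℕ} (hr : r ≠ 0) (h : (r, c) ∈ hookCells a i) :
    T r c ∉ (Finset.range (i + 1)).image (T 0) := by
  intro hc
  obtain ⟨k, hk, hkj⟩ := Finset.mem_image.1 hc
  rw [Finset.mem_range] at hk
  exact hr (eq_of_eq hT (mem_hookCells.2 (by omega)) h hkj).1.symm

theorem Skyt.corner : T 0 0 = 1 := by
  have ha := (mem_Skyt_iff.1 hT).1
  obtain ⟨r, c, h1, h2⟩ := exists_cell hT le_rfl (by omega : 1 ≤ a + 2 * i)
  have h3 := mem_Icc hT (r := 0) (c := 0) (mem_hookCells.2 (by omega))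
  rw [mem_hookCells] at h1
  by_contra hne
  rcases h1 with ⟨h4, h5⟩ | ⟨h4, h5, rfl⟩
  · have h6 := row_le (row_zero hT) (Nat.zero_le c) h5
    have h7 := lt_col hT c h5
    obtain rfl | rfl : r = 0 ∨ r = 1 := by omega
    · omega
    · omega
  · have := col_zero hT 0 r (by omega) h5
    omega

/-- The first entry of the second row is the smallest outside the first row. -/
theorem Skyt.gaps_secondRow_zero :
    gaps ((Finset.range (i + 1)).image (T 0)) (secondRow a i T 0) = 0 := by
  have h1 := mem_Icc hT (r := 1) (c := 0) (mem_hookCells.2 (by omega))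
  rw [secondRow, if_pos (Nat.zero_le i), gaps, Finset.card_eq_zero,
    Finset.sdiff_eq_empty_iff_subset]
  intro e he
  rw [Finset.mem_Ico] at he
  obtain ⟨r, c, h2, rfl⟩ := exists_cell hT he.1 (by omega)
  rw [mem_hookCells] at h2
  rw [Finset.mem_image]
  rcases h2 with ⟨h4, h5⟩ | ⟨h4, h5, rfl⟩
  · obtain rfl | rfl : r = 0 ∨ r = 1 := by omega
    · exact ⟨c, by rw [Finset.mem_range]; omega, rfl⟩
    · have h6 := row_le (row_one hT) (Nat.zero_le c) h5
      omega
  · have := col_zero hT 1 r (by omega) h5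
    omega

theorem Skyt.secondRow_lt {j : ℕ} (hj : j ≤ i) :
    1 ≤ secondRow a i T j ∧ secondRow a i T j < secondRow a i T (j + 1) := by
  have h1 := mem_Icc hT (r := 1) (c := j) (mem_hookCells.2 (by omega))
  simp only [secondRow, if_pos hj]
  split_ifs with h2
  · exact ⟨h1.1, row_one hT j (j + 1) (by omega) h2⟩
  · omega

/-- The entry `T 0 j` lies in the first row, which is removed from the interval, so it is counted
separately. -/
theorem Skyt.card_nomBlock {j : ℕ} (hj : j ≤ i) : (nomBlock a i T j).card =
    1 + (gaps ((Finset.range (i + 1)).image (T 0)) (secondRow a i T (j + 1)) -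
      gaps ((Finset.range (i + 1)).image (T 0)) (secondRow a i T j)) := by
  obtain ⟨h1, h2⟩ := secondRow_lt hT hj
  have h3 : (if j < i then T 1 (j + 1) else a + 2 * i + 1) = secondRow a i T (j + 1) := by
    simp only [secondRow, Nat.succ_le_iff]
  have h4 : T 1 j = secondRow a i T j := by rw [secondRow, if_pos hj]
  rw [nomBlock, h3, h4, toFinset_firstRow, Finset.card_insert_of_notMem, ← gaps_add_card h1 h2.le]
  · omega
  · rw [Finset.mem_sdiff, not_and_not_right]
    exact fun _ => Finset.mem_image.2 ⟨j, by rw [Finset.mem_range]; omega, rfl⟩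

theorem Skyt.gaps_secondRow_lt {j : ℕ} (hj : j ≤ i) :
    gaps ((Finset.range (i + 1)).image (T 0)) (secondRow a i T j) <
      gaps ((Finset.range (i + 1)).image (T 0)) (secondRow a i T (j + 1)) := by
  obtain ⟨h1, h2⟩ := secondRow_lt hT hj
  refine gaps_lt h1 ?_ h2
  rw [secondRow, if_pos hj]
  exact notMem_row hT one_ne_zero (mem_hookCells.2 (by omega))

/-- The sum telescopes, starting from `0` because `y_1` is the smallest entry outside the first row.
-/
theorem Skyt.sum_card_nomBlock {j : ℕ} (hj : j ≤ i + 1) :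
    ∑ k ∈ Finset.range j, (nomBlock a i T k).card =
      j + gaps ((Finset.range (i + 1)).image (T 0)) (secondRow a i T j) := by
  induction j with
  | zero => rw [gaps_secondRow_zero hT]; rfl
  | succ j ih =>
    rw [Finset.sum_range_succ, ih (by omega), card_nomBlock hT (by omega)]
    have := gaps_secondRow_lt hT (j := j) (by omega)
    omega

theorem Skyt.two_le_card_nomBlock {j : ℕ} (hj : j ≤ i) : 2 ≤ (nomBlock a i T j).card := by
  rw [card_nomBlock hT hj]
  have := gaps_secondRow_lt hT hj
  omega

theorem Skyt.peaks_skytSteps :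
    peaks (a + 2 * i + 2) (skytSteps a i T) = firstRow i T := by
  refine peaks_stepsOf (row_zero hT) (fun j hj => ?_) (corner hT).ge ?_
  · have := two_le_card_nomBlock hT hj
    omega
  · have := (mem_Icc hT (r := 0) (c := i) (mem_hookCells.2 (by omega))).2
    omega

theorem Skyt.map_skytSteps :
    (peaks (a + 2 * i + 2) (skytSteps a i T)).map (skytSteps a i T) = nomSizes a i T := by
  rw [peaks_skytSteps hT, firstRow, nomSizes, List.map_map]
  refine List.map_congr_left fun j hj => ?_
  rw [List.mem_range] at hj
  exact stepsOf_apply (row_zero hT) (by omega)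

theorem Skyt.gaps_total :
    1 + (i + 1) + gaps ((Finset.range (i + 1)).image (T 0)) (a + 2 * i + 1) = a + 2 * i + 1 := by
  refine gaps_row (row_zero hT) (corner hT).ge le_rfl (by omega) fun k hk => ?_
  have := (mem_Icc hT (r := 0) (c := k) (mem_hookCells.2 (by omega))).2
  omega

theorem Skyt.skytSteps_mem : skytSteps a i T ∈ LukSeq (a + 2 * i + 2) (i + 1) := by
  have h0 := corner hT
  refine ⟨?_, fun v hv => ?_, ?_⟩
  · rw [skytSteps, isLukasiewicz_stepsOf_iff (row_zero hT)
      (fun j hj => by have := two_le_card_nomBlock hT hj; omega) h0.ge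
      (mem_Icc hT (r := 0) (c := i) (mem_hookCells.2 (by omega))).2]
    refine ⟨fun j hj => ?_, ?_⟩
    · have h1 := row_le (row_zero hT) (Nat.zero_le j) hj
      rw [sum_card_nomBlock hT (by omega), ← add_assoc]
      conv_lhs => rw [← gaps_row (row_zero hT) h0.ge (v := T 0 j) (j := j) (by omega) (by omega)
        (fun k hk => row_lt_iff (row_zero hT) hk hj)]
      rw [secondRow, if_pos hj]
      -- The path condition at `T 0 j` is the column condition `T 0 j < T 1 j` seen through `gaps`.
      exact Nat.add_le_add_left (gaps_mono _ (lt_col hT j hj).le) _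
    · have := gaps_total hT
      rw [sum_card_nomBlock hT le_rfl, secondRow, if_neg (by omega)]
      omega
  · obtain ⟨j, hj, rfl⟩ := (stepsOf_ne_zero_iff (row_zero hT)
      (fun j hj => by have := two_le_card_nomBlock hT hj; omega)).1
      (by rw [skytSteps] at hv; omega : stepsOf i (T 0) (fun j => (nomBlock a i T j).card) v ≠ 0)
    rw [skytSteps, stepsOf_apply (row_zero hT) hj] at hv
    have := two_le_card_nomBlock hT hj
    omega
  · rw [peaks_skytSteps hT, firstRow, List.length_map, List.length_range]

theorem Skyt.column_eq (h : (columnEntries (a + 2 * i) i (T 0) (T 1)).card = a - 2) (k : Fin (a - 2)) :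
    T (k + 2) 0 = (columnEntries (a + 2 * i) i (T 0) (T 1)).orderEmbOfFin h k := by
  refine congrFun (Finset.orderEmbOfFin_unique h (f := fun k : Fin (a - 2) => T (k + 2) 0)
    (fun k => ?_) fun k l hkl => ?_) k
  · have hcell : ((k : ℕ) + 2, 0) ∈ hookCells a i := mem_hookCells.2 (by omega)
    rw [columnEntries, Finset.mem_sdiff, Finset.mem_sdiff, Finset.mem_Icc]
    refine ⟨⟨mem_Icc hT hcell, notMem_row hT (by omega) hcell⟩, fun hc => ?_⟩
    obtain ⟨j, hj, hjk⟩ := Finset.mem_image.1 hc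
    rw [Finset.mem_range] at hj
    have := (eq_of_eq hT (mem_hookCells.2 (by omega)) hcell hjk).1
    omega
  · exact col_zero hT _ _ (by simpa using hkl) (by omega)

end Skyt

/-- The peaks give the first row, the partial sums of the terms give `gaps` at the second row and
hence the second row, and the remaining entries fill the first column in increasing order. -/
theorem skytSteps_injOn (a i : ℕ) : Set.InjOn (skytSteps a i) (Skyt a i 2) := by
  intro T hT T' hT' h
  have hx : ∀ j ≤ i, T 0 j = T' 0 j := by
    have h1 := Skyt.peaks_skytSteps hT
    rw [h, Skyt.peaks_skytSteps hT', firstRow, firstRow, List.map_inj_left] at h1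
    exact fun j hj => (h1 j (by rw [List.mem_range]; omega)).symm
  have hX : (Finset.range (i + 1)).image (T 0) = (Finset.range (i + 1)).image (T' 0) :=
    Finset.image_congr fun j hj => hx j (by simpa [Nat.lt_succ_iff] using hj)
  have hα : ∀ j ≤ i, (nomBlock a i T j).card = (nomBlock a i T' j).card := by
    intro j hj
    have h1 := congrFun h (T 0 j)
    rwa [skytSteps, stepsOf_apply (Skyt.row_zero hT) hj, hx j hj, skytSteps,
      stepsOf_apply (Skyt.row_zero hT') hj] at h1
  have hy : ∀ j ≤ i, T 1 j = T' 1 j := by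
    intro j hj
    have h1 := Skyt.sum_card_nomBlock hT (j := j) (by omega)
    rw [Finset.sum_congr rfl fun k hk => hα k (by rw [Finset.mem_range] at hk; omega),
      Skyt.sum_card_nomBlock hT' (by omega), secondRow, secondRow, if_pos hj, if_pos hj, hX] at h1
    have hc : (1, j) ∈ hookCells a i := mem_hookCells.2 (by omega)
    refine gaps_inj (Skyt.mem_Icc hT hc).1 ?_ (Skyt.mem_Icc hT' hc).1
      (Skyt.notMem_row hT' one_ne_zero hc) (by omega)
    rw [← hX]
    exact Skyt.notMem_row hT one_ne_zero hc
  have hC : columnEntries (a + 2 * i) i (T 0) (T 1) = columnEntries (a + 2 * i) i (T' 0) (T' 1) := by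
    rw [columnEntries, columnEntries, hX, Finset.image_congr (f := T 1) (g := T' 1)
      fun j hj => hy j (by simpa [Nat.lt_succ_iff] using hj)]
  have hcard := card_columnEntries (a := a) (Skyt.row_zero hT) (Skyt.row_one hT)
    (fun j hj => Finset.mem_Icc.2 (Skyt.mem_Icc hT (mem_hookCells.2 (by omega))))
    (fun j hj => Finset.mem_Icc.2 (Skyt.mem_Icc hT (mem_hookCells.2 (by omega))))
    (fun j hj => Skyt.notMem_row hT one_ne_zero (mem_hookCells.2 (by omega)))
  funext r c
  by_cases hrc : (r, c) ∈ hookCells a i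
  · rcases mem_hookCells.1 hrc with ⟨h1, h2⟩ | ⟨h1, h2, rfl⟩
    · obtain rfl | rfl : r = 0 ∨ r = 1 := by omega
      · exact hx c h2
      · exact hy c h2
    · have h3 := Skyt.column_eq hT hcard ⟨r - 2, by omega⟩
      have h4 := Skyt.column_eq hT' (hC ▸ hcard) ⟨r - 2, by omega⟩
      simp only [Nat.sub_add_cancel h1] at h3 h4
      rw [h3, h4]
      congr
  · rw [(mem_Skyt_iff.1 hT).2.1 r c hrc, (mem_Skyt_iff.1 hT').2.1 r c hrc]

/-- The tableau with first row `x`, second row `y` and column `c` below. -/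
def tableauOf (a i : ℕ) (x y c : ℕ → ℕ) (r s : ℕ) : ℕ :=
  if r = 0 ∧ s ≤ i then x s else if r = 1 ∧ s ≤ i then y s
  else if 2 ≤ r ∧ r < a ∧ s = 0 then c (r - 2) else 0

theorem tableauOf_mem {a i : ℕ} {x y c : ℕ → ℕ} (ha : 2 ≤ a)
    (hx : ∀ j k, j < k → k ≤ i → x j < x k) (hy : ∀ j k, j < k → k ≤ i → y j < y k)
    (hxm : ∀ j ≤ i, x j ∈ Finset.Icc 1 (a + 2 * i))
    (hym : ∀ j ≤ i, y j ∈ Finset.Icc 1 (a + 2 * i)) (hxy : ∀ j ≤ i, x j < y j)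
    (hc : ∀ k l, k < l → l < a - 2 → c k < c l)
    (hcm : ∀ e, e ∈ columnEntries (a + 2 * i) i x y ↔ ∃ k < a - 2, c k = e)
    (hyc : ∀ k < a - 2, y 0 < c k) : tableauOf a i x y c ∈ Skyt a i 2 := by
  have h0 : ∀ s ≤ i, tableauOf a i x y c 0 s = x s := fun s hs => by
    rw [tableauOf, if_pos ⟨rfl, hs⟩]
  have h1 : ∀ s ≤ i, tableauOf a i x y c 1 s = y s := fun s hs => by
    rw [tableauOf, if_neg (by omega), if_pos ⟨rfl, hs⟩]
  have h2 : ∀ r, 2 ≤ r → r < a → tableauOf a i x y c r 0 = c (r - 2) := fun r hr hr' => by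
    rw [tableauOf, if_neg (by omega), if_neg (by omega), if_pos ⟨hr, hr', rfl⟩]
  have hmaps : Set.MapsTo (fun p : ℕ × ℕ => tableauOf a i x y c p.1 p.2) (hookCells a i)
      (Finset.Icc 1 (a + 2 * i)) := by
    rintro ⟨r, s⟩ hrs
    rw [Finset.mem_coe, mem_hookCells] at hrs
    rw [Finset.mem_coe]
    rcases hrs with ⟨h4, h5⟩ | ⟨h4, h5, rfl⟩
    · obtain rfl | rfl : r = 0 ∨ r = 1 := by omega
      · simpa only [h0 s h5] using hxm s h5
      · simpa only [h1 s h5] using hym s h5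
    · have := (hcm _).2 ⟨r - 2, by omega, rfl⟩
      simp only [h2 r h4 h5]
      exact (Finset.mem_sdiff.1 (Finset.mem_sdiff.1 this).1).1
  have hsurj : Set.SurjOn (fun p : ℕ × ℕ => tableauOf a i x y c p.1 p.2) (hookCells a i)
      (Finset.Icc 1 (a + 2 * i)) := by
    intro e he
    by_cases hex : e ∈ (Finset.range (i + 1)).image x
    · obtain ⟨j, hj, rfl⟩ := Finset.mem_image.1 hex
      rw [Finset.mem_range] at hj
      exact ⟨(0, j), Finset.mem_coe.2 (mem_hookCells.2 (by omega)), h0 j (by omega)⟩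
    by_cases hey : e ∈ (Finset.range (i + 1)).image y
    · obtain ⟨j, hj, rfl⟩ := Finset.mem_image.1 hey
      rw [Finset.mem_range] at hj
      exact ⟨(1, j), Finset.mem_coe.2 (mem_hookCells.2 (by omega)), h1 j (by omega)⟩
    obtain ⟨k, hk, rfl⟩ := (hcm e).1 (Finset.mem_sdiff.2
      ⟨Finset.mem_sdiff.2 ⟨Finset.mem_coe.1 he, hex⟩, hey⟩)
    exact ⟨(k + 2, 0), Finset.mem_coe.2 (mem_hookCells.2 (by omega)),
      h2 (k + 2) (by omega) (by omega)⟩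
  rw [mem_Skyt_iff]
  refine ⟨ha, fun r s hrs => ?_, ⟨hmaps, ?_, hsurj⟩, fun j k hj hk => ?_, fun j k hj hk => ?_,
    fun j hj => ?_, fun r s hrs hs => ?_⟩
  · rw [mem_hookCells] at hrs
    rw [tableauOf, if_neg (by omega), if_neg (by omega), if_neg (by omega)]
  · exact Finset.injOn_of_surjOn_of_card_le _ hmaps hsurj
      (by rw [card_hookCells ha, Nat.card_Icc, Nat.add_sub_cancel])
  · rw [h0 j (by omega), h0 k hk]
    exact hx j k hj hk
  · rw [h1 j (by omega), h1 k hk]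
    exact hy j k hj hk
  · rw [h0 j hj, h1 j hj]
    exact hxy j hj
  · have hxy0 := hxy 0 (Nat.zero_le i)
    rcases r with _ | _ | r
    · rw [h0 0 (Nat.zero_le i)]
      rcases s with _ | _ | s
      · omega
      · rw [zero_add, h1 0 (Nat.zero_le i)]
        exact hxy0
      · rw [h2 _ (by omega) hs]
        have := hyc (s + 1 + 1 - 2) (by omega)
        omega
    · rw [zero_add, h1 0 (Nat.zero_le i), h2 _ (by omega) hs]
      exact hyc _ (by omega)
    · rw [h2 _ (by omega) (by omega), h2 _ (by omega) hs]
      exact hc _ _ (by omega) (by omega)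

theorem LukSeq.exists_stepsOf {m i : ℕ} (hm : 1 ≤ m) {o : ℕ → ℕ} (ho : o ∈ LukSeq (m + 2) (i + 1)) :
    ∃ x α : ℕ → ℕ, o = stepsOf i x α ∧ (∀ j k, j < k → k ≤ i → x j < x k) ∧
      (∀ j ≤ i, 1 ≤ x j ∧ x j ≤ m) ∧ ∀ j ≤ i, 2 ≤ α j := by
  obtain ⟨h, h1, h2⟩ := ho
  set x : ℕ → ℕ := fun j => (peaks (m + 2) o).getD j 0 with hx
  have hget : ∀ j (hj : j ≤ i), x j = (peaks (m + 2) o)[j]'(by omega) := fun j hj =>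
    List.getD_eq_getElem _ _ _
  have hmem : ∀ j ≤ i, o (x j) ≠ 0 := fun j hj => by
    rw [← mem_peaks h, hget j hj]
    exact List.getElem_mem _
  have hlt : ∀ j k, j < k → k ≤ i → x j < x k := by
    intro j k hj hk
    rw [hget j (by omega), hget k hk]
    exact (sortedLT_peaks _ _).getElem_lt_getElem_of_lt hj
  refine ⟨x, fun j => o (x j), ?_, hlt, fun j hj => ?_, fun j hj => ?_⟩
  · funext u
    by_cases hu : o u = 0
    · rw [hu, stepsOf_of_forall_ne]
      rintro j hj rfl
      exact hmem j hj hu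
    · obtain ⟨j, hj, hju⟩ := List.getElem_of_mem ((mem_peaks h).2 hu)
      rw [h2] at hj
      rw [← hget j (by omega)] at hju
      rw [← hju, stepsOf_apply hlt (by omega)]
  · have h3 := ((isLukasiewicz_iff (by omega)).1 h).1 _ (hmem j hj)
    omega
  · have := hmem j hj
    have := h1 (x j)
    simp only
    omega

theorem skytSteps_surjOn {a : ℕ} (ha : 2 ≤ a) (i : ℕ) :
    Set.SurjOn (skytSteps a i) (Skyt a i 2) (LukSeq (a + 2 * i + 2) (i + 1)) := by
  intro o ho
  obtain ⟨x, α, rfl, hx, hxm, hα⟩ := LukSeq.exists_stepsOf (by omega) ho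
  have hα0 : ∀ j ≤ i, α j ≠ 0 := fun j hj => by have := hα j hj; omega
  have hx0 := (hxm 0 (Nat.zero_le i)).1
  obtain ⟨hpre, hsum⟩ := (isLukasiewicz_stepsOf_iff hx hα0 hx0 (hxm i le_rfl).2).1 ho.1
  set X := (Finset.range (i + 1)).image x with hX
  -- The prescribed value of `gaps X` at `y j`: each earlier block has one entry in `X` and `α k -
  -- 1` entries outside it.
  set σ : ℕ → ℕ := fun j => ∑ k ∈ Finset.range j, (α k - 1) with hσ
  have hσα : ∀ j ≤ i + 1, σ j + j = ∑ k ∈ Finset.range j, α k := by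
    intro j hj
    induction j with
    | zero => rfl
    | succ j ih =>
      have h1 := ih (by omega)
      have h2 := hα j (by omega)
      simp only [hσ] at h1 ⊢
      rw [Finset.sum_range_succ, Finset.sum_range_succ, ← h1]
      omega
  have hσmono : ∀ j k, j < k → k ≤ i + 1 → σ j < σ k := by
    intro j k hj hk
    induction k with
    | zero => omega
    | succ k ih =>
      have h2 := hα k (by omega)
      have h3 : σ (k + 1) = σ k + (α k - 1) := Finset.sum_range_succ _ _
      rcases (Nat.lt_succ_iff.1 hj).eq_or_lt with rfl | hjk
      · omega
      · have := ih hjk (by omega)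
        omega
  have hgaps : σ (i + 1) = gaps X (a + 2 * i + 1) := by
    have h1 : _ + gaps X _ = _ := gaps_row hx hx0 (v := a + 2 * i + 1) (j := i + 1) le_rfl (by omega)
      (fun k hk => by have := hxm k hk; omega)
    have h2 := hσα (i + 1) le_rfl
    omega
  have hex : ∀ j, ∃ y, j ≤ i → 1 ≤ y ∧ y ≤ a + 2 * i ∧ y ∉ X ∧ gaps X y = σ j := by
    intro j
    by_cases hj : j ≤ i
    · obtain ⟨y, hy⟩ := exists_gaps_eq (X := X) (s := σ j) (m := a + 2 * i)
        (by rw [← hgaps]; exact hσmono j (i + 1) (by omega) le_rfl)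
      exact ⟨y, fun _ => hy⟩
    · exact ⟨0, fun h => absurd h hj⟩
  choose y hy using hex
  have hylt : ∀ j k, j < k → k ≤ i → y j < y k := by
    intro j k hj hk
    by_contra hc
    have h1 := gaps_mono X (not_lt.mp hc)
    rw [(hy j (by omega)).2.2.2, (hy k hk).2.2.2] at h1
    have := hσmono j k hj (by omega)
    omega
  have hxy : ∀ j ≤ i, x j < y j := by
    intro j hj
    obtain ⟨h1, h2, h3, h4⟩ := hy j hj
    have h5 : _ + gaps X _ = _ := gaps_row hx hx0 (v := x j) (j := j) (by omega) (hxm j hj).1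
      (fun k hk => row_lt_iff hx hk hj)
    have h6 := hpre j hj
    rw [← hσα j (by omega)] at h6
    -- Here `gaps X (x j) ≤ σ j = gaps X (y j)`; since `y j` is not in `X`, having `y j < x j` would
    -- make the inequality fail.
    by_contra hc
    rcases (not_lt.mp hc).eq_or_lt with h7 | h7
    · exact h3 (Finset.mem_image.2 ⟨j, by rw [Finset.mem_range]; omega, h7.symm⟩)
    · have := gaps_lt h1 h3 h7
      omega
  have hxm' : ∀ j ≤ i, x j ∈ Finset.Icc 1 (a + 2 * i) := fun j hj => Finset.mem_Icc.2 (hxm j hj)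
  have hym' : ∀ j ≤ i, y j ∈ Finset.Icc 1 (a + 2 * i) := fun j hj =>
    Finset.mem_Icc.2 ⟨(hy j hj).1, (hy j hj).2.1⟩
  have hcard := card_columnEntries hx hylt hxm' hym' fun j hj => (hy j hj).2.2.1
  set C := columnEntries (a + 2 * i) i x y with hC
  set c : ℕ → ℕ := fun k => if hk : k < a - 2 then C.orderEmbOfFin hcard ⟨k, hk⟩ else 0 with hc
  have hcm : ∀ e, e ∈ C ↔ ∃ k < a - 2, c k = e := by
    intro e
    rw [← Finset.mem_coe, ← Finset.range_orderEmbOfFin C hcard, Set.mem_range]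
    constructor
    · rintro ⟨k, rfl⟩
      exact ⟨k, k.2, by simp [hc]⟩
    · rintro ⟨k, hk, rfl⟩
      exact ⟨⟨k, hk⟩, by simp [hc, hk]⟩
  have hT : tableauOf a i x y c ∈ Skyt a i 2 := by
    refine tableauOf_mem ha hx hylt hxm' hym' hxy (fun k l hkl hl => ?_) hcm fun k hk => ?_
    · simp only [hc, dif_pos hl, dif_pos (hkl.trans hl)]
      exact (C.orderEmbOfFin hcard).strictMono (by simpa using hkl)
    · have h1 := (hcm _).2 ⟨k, hk, rfl⟩
      rw [hC, columnEntries, Finset.mem_sdiff, Finset.mem_sdiff, Finset.mem_Icc] at h1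
      obtain ⟨⟨h2, h3⟩, h4⟩ := h1
      by_contra hc
      rcases (not_lt.mp hc).eq_or_lt with h5 | h5
      · exact h4 (Finset.mem_image.2 ⟨0, by simp, h5.symm⟩)
      -- Nothing outside `X` lies below `y 0`, as `gaps X (y 0) = σ 0 = 0`.
      · have h6 := gaps_lt h2.1 h3 h5
        rw [(hy 0 (Nat.zero_le i)).2.2.2] at h6
        simp [hσ] at h6
  have hT0 : ∀ j ≤ i, tableauOf a i x y c 0 j = x j := fun j hj => by
    rw [tableauOf, if_pos ⟨rfl, hj⟩]
  have hX' : (Finset.range (i + 1)).image (tableauOf a i x y c 0) = X :=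
    Finset.image_congr fun j hj => hT0 j (by simpa [Nat.lt_succ_iff] using hj)
  have hrow : ∀ j ≤ i + 1, gaps X (secondRow a i (tableauOf a i x y c) j) = σ j := by
    intro j hj
    rcases hj.eq_or_lt with rfl | hj
    · rw [secondRow, if_neg (by omega), hgaps]
    · rw [secondRow, if_pos (by omega), tableauOf, if_neg (by omega), if_pos ⟨rfl, by omega⟩]
      exact (hy j (by omega)).2.2.2
  refine ⟨_, hT, ?_⟩
  funext u
  rw [skytSteps, stepsOf, stepsOf]
  refine Finset.sum_congr rfl fun j hj => ?_
  rw [Finset.mem_range] at hj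
  have h3 : σ (j + 1) = σ j + (α j - 1) := Finset.sum_range_succ _ _
  have h4 := hα j (by omega)
  rw [hT0 j (by omega), Skyt.card_nomBlock hT (by omega), hX', hrow j (by omega),
    hrow (j + 1) (by omega), h3]
  congr 1
  omega

theorem bijOn_skytSteps {n i : ℕ} : Set.BijOn (skytSteps (n - i + 1) i) (Skyt (n - i + 1) i 2)
    (LukSeq (n + i + 3) (i + 1)) := by
  by_cases hni : i < n
  · have hN : n + i + 3 = (n - i + 1) + 2 * i + 2 := by omega
    rw [hN]
    exact ⟨fun T hT => Skyt.skytSteps_mem hT, skytSteps_injOn _ _, skytSteps_surjOn (by omega) i⟩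
  -- For `i ≥ n` truncated subtraction gives `a = 1`, so there are no tableaux; nor are there
  -- sequences, since `i + 1` terms of at least `2` cannot add up to `n + i + 1`.
  · have h1 : Skyt (n - i + 1) i 2 = ∅ := by
      refine Set.eq_empty_of_forall_notMem fun T hT => ?_
      have := (mem_Skyt_iff.1 hT).1
      omega
    have h2 : LukSeq (n + i + 3) (i + 1) = ∅ := by
      refine Set.eq_empty_of_forall_notMem fun o ho => ?_
      obtain ⟨x, α, rfl, hx, hxm, hα⟩ := LukSeq.exists_stepsOf (m := n + i + 1) (by omega) ho
      have h3 := ((isLukasiewicz_stepsOf_iff hx (fun j hj => by have := hα j hj; omega)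
        (hxm 0 (Nat.zero_le i)).1 (hxm i le_rfl).2).1 ho.1).2
      have h4 : (Finset.range (i + 1)).card • 2 ≤ ∑ k ∈ Finset.range (i + 1), α k :=
        Finset.card_nsmul_le_sum _ _ _ fun j hj => hα j (by rw [Finset.mem_range] at hj; omega)
      rw [h3, Finset.card_range, smul_eq_mul] at h4
      omega
    rw [h1, h2]
    exact Set.bijOn_empty _

/-- The word of a tableau is the word of its sequence. -/
theorem skytWord_eq {n i : ℕ} {T : ℕ → ℕ → ℕ} (hT : T ∈ Skyt (n - i + 1) i 2) :
    skytWord (n - i + 1) i T = pathWord (n + i + 3) (skytSteps (n - i + 1) i T) := by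
  have ha := (mem_Skyt_iff.1 hT).1
  have hN : n + i + 3 = (n - i + 1) + 2 * i + 2 := by omega
  have h0 := Skyt.corner hT
  have h1 := (Skyt.mem_Icc hT (r := 0) (c := i) (mem_hookCells.2 (by omega))).2
  rw [pathWord, hN, Skyt.map_skytSteps hT, Skyt.peaks_skytSteps hT, skytWord, h0]
  have h2 : (firstRow i T).getLastD 0 = T 0 i := by
    rw [firstRow, List.range_succ, List.map_append]
    simp
  rw [h2]
  congr 4
  omega

end FanDyck

/-! ### The bijections, composed through Łukasiewicz sequences -/

open FanDyck
theorem mainTheorem2 (n i : ℕ) (hn : 1 ≤ n) :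
    ∃ (skytDyck : Skyt (n - i + 1) i 2 ≃ Dyck (n + i + 1) (i + 1) 0)
      (skytTri : Skyt (n - i + 1) i 2 ≃ Tri (n + i + 3) (i + 1) 0)
      (triDyck : Tri (n + i + 3) (i + 1) 0 ≃ Dyck (n + i + 1) (i + 1) 0)
      (triDis : Tri (n + i + 3) (i + 1) 0 ≃ Dis (n + 2) i),
      (∀ T, (skytDyck T).1.toList = skytWord (n - i + 1) i T.1) ∧
      (∀ T, fanSizes (n + i + 3) (skytTri T).1 = nomSizes (n - i + 1) i T.1 ∧
        diffs (fanOrigins (n + i + 3) (skytTri T).1) = diffs (firstRow i T.1)) ∧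
      (∀ T, (triDyck T).1.toList = triWord (n + i + 3) T.1) ∧
      (∀ T, (triDis T).1 = contract (n + i + 3) T.1) ∧
      (∀ D, (triDis.symm D).1 = expand (n + i + 3) D.1) := by
  have hS := bijOn_skytSteps (n := n) (i := i)
  have hP := bijOn_pathTri (show 3 ≤ n + i + 3 by omega) (i + 1)
  have hW := bijOn_pathWord (show 3 ≤ n + i + 3 by omega) (i + 1)
  obtain ⟨hC, hE⟩ := bijOn_contract (i := i) hn
  have hinj : Function.Injective DyckWord.toList := fun _ _ => DyckWord.ext
  set eS := Set.BijOn.equiv _ hS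
  set eP := Set.BijOn.equiv _ hP
  -- `pathWord` produces plain words; injectivity of `DyckWord.toList` turns these back into Dyck
  -- paths.
  set eW := (Set.BijOn.equiv _ hW).trans (Equiv.Set.image _ _ hinj).symm
  have hwW : ∀ o, (eW o).1.toList = pathWord (n + i + 3) o.1 := fun o =>
    congrArg Subtype.val ((Equiv.Set.image _ (Dyck (n + i + 1) (i + 1) 0) hinj).apply_symm_apply
      (Set.BijOn.equiv _ hW o))
  refine ⟨eS.trans eW, eS.trans eP, eP.symm.trans eW, (Set.BijOn.equiv _ hC), fun T => ?_, fun T => ?_,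
    fun T => ?_, fun T => rfl, fun D => ?_⟩
  · rw [skytWord_eq T.2]
    exact hwW (eS T)
  · have hN : n + i + 3 = (n - i + 1) + 2 * i + 2 := by
      have := (mem_Skyt_iff.1 T.2).1
      omega
    have hL := (hS.mapsTo T.2).1
    have hT : ((eS.trans eP) T).1 = pathTri (n + i + 3) (skytSteps (n - i + 1) i T.1) := rfl
    rw [hT, fanSizes_pathTri hL, fanOrigins_pathTri hL, hN]
    exact ⟨Skyt.map_skytSteps T.2, by rw [Skyt.peaks_skytSteps T.2]⟩
  · obtain ⟨o, rfl⟩ := eP.surjective T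
    rw [Equiv.trans_apply, Equiv.symm_apply_apply, hwW]
    exact (triWord_pathTri o.2.1).symm
  -- Every dissection is a contraction, so the left inverse `expand` is the inverse.
  · obtain ⟨T, rfl⟩ := (Set.BijOn.equiv _ hC).surjective D
    rw [Equiv.symm_apply_apply]
    exact (hE T.1 T.2).symm
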